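/- Let $n\in\mathbb N$, $s\in(0,1)$ and $0<\lambda\le\Lambda$. Let $\mathcal K_{\rm sym}$ be the set of measurable kernels $K:\mathbb R^n\setminus\{0\}\to\mathbb R$ with $K(z)=K(-z)$ and $\lambda|z|^{-n-2s}\le K(z)\le\Lambda|z|^{-n-2s}$ for all $z\ne0$, and put $$L_Ku(x)=\int_{\mathbb R^n}\bigl[u(x+z)-u(x)-1_{\{2s\in[1,2)\}}1_B(z)\,\nabla u(x)\cdot z\bigr]K(z)\,dz,$$ where $B$ is the unit ball. Let $\omega_s(z)=(1+|z|)^{-n-2s}$, let $L^1(\omega_s)$ be the space of functions integrable with respect to $\omega_s(z)\,dz$, and write $u\in C^{1,1}(x)$ if there are $p\in\mathbb R^n$, $M\in\mathbb R$ and $r>0$ with $|u(x+z)-u(x)-p\cdot z|\le M|z|^2$ for $|z|<r$. Let $\mathcal I_{\rm sym}$ be an operator for which $\mathcal I_{\rm sym}u(x)\in\mathbb R$ is defined whenever $u\in C^{1,1}(x)\cap L^1(\omega_s)$ and which is translation invariant, $\mathcal I_{\rm sym}[u(\cdot+h)](x)=\mathcal I_{\rm sym}u(x+h)$, positively $1$-homogeneous,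 $\mathcal I_{\rm sym}(tu)=t\,\mathcal I_{\rm sym}u$ for $t>0$, and elliptic with respect to $\mathcal K_{\rm sym}$: $$\inf_{K\in\mathcal K_{\rm sym}}\bigl(L_Ku(x)-L_Kv(x)\bigr)\le\mathcal I_{\rm sym}u(x)-\mathcal I_{\rm sym}v(x)\le\sup_{K\in\mathcal K_{\rm sym}}\bigl(L_Ku(x)-L_Kv(x)\bigr)$$ for all $u,v\in C^{1,1}(x)\cap L^1(\omega_s)$. Let $f:(0,\infty)\to\mathbb R$ be continuous and non-increasing. A measurable, upper semicontinuous function $u:\mathbb R^n\to(0,\infty)$ in $L^1(\omega_s)$ is a viscosity subsolution of $$-\mathcal I_{\rm sym}u=f(u)\quad\text{in }\mathbb R^n\qquad(*)$$ if, for all $x_0\in\mathbb R^n$, $r>0$ and $\varphi\in C^2(B_r(x_0))$ with $\varphi(x_0)=u(x_0)$ and $u\le\varphi$ in $B_r(x_0)$ such that the function $v$ equal to $\varphi$ on $B_r(x_0)$ and to $u$ elsewhere belongs to $L^1(\omega_s)$, one has $-\mathcal I_{\rm sym}v(x_0)\le f(u(x_0))$. Viscosity supersolutions are defined in the same way, with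 lower semicontinuity and both inequalities $u\le\varphi$ and $-\mathcal I_{\rm sym}v(x_0)\le f(u(x_0))$ reversed. A viscosity solution is a function that is both. Let $\gamma\in\mathbb R$, and suppose that one of the following holds: (i) $\gamma<\min\{1,2s\}$; (ii) $s>1/2$, $f$ is $C^1$ and convex, and for some $\beta\in(0,1)$ $$\limsup_{R\to\infty}R^{2s-(2-\beta)\gamma}\,|f'(R^\gamma)|^{\frac{2s-1}{2s}}=\infty.$$ Then $(*)$ has no non-constant positive viscosity solution $u$ for which there is a constant $C$ with $|u(x)|\le C(1+|x|)^\gamma$ for all $x\in\mathbb R^n$. -/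

import Mathlib

open MeasureTheory Set Filter Topology

noncomputable section

namespace NonlocalLiouville

/-- The space `ℝⁿ` with its Euclidean norm. -/
abbrev Rn (n : ℕ) := EuclideanSpace ℝ (Fin n)

/-- The weight `ω_s(z) = (1 + |z|)^(-n-2s)`. -/
def weight (n : ℕ) (s : ℝ) (z : Rn n) : ℝ := (1 + ‖z‖) ^ (-(n : ℝ) - 2 * s)

/-- `u ∈ L¹(ω_s)`. -/
def MemL1Weight {n : ℕ} (s : ℝ) (u : Rn n → ℝ) : Prop :=
  Integrable (fun z => u z * weight n s z) volume

/-- `u ∈ C^{1,1}(x)`: `u` agrees with an affine function up to a quadratic error near `x`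
(in particular `u` is differentiable at `x`). -/
def C11At {n : ℕ} (u : Rn n → ℝ) (x : Rn n) : Prop :=
  ∃ p : Rn n →L[ℝ] ℝ, ∃ M r : ℝ, 0 < r ∧
    ∀ z : Rn n, ‖z‖ < r → |u (x + z) - u x - p z| ≤ M * ‖z‖ ^ 2

/-- The class `𝒦_sym(lam, Lam)` of symmetric measurable kernels `K` with
`lam / |z|^(n+2s) ≤ K z ≤ Lam / |z|^(n+2s)` for `z ≠ 0`. The value `K 0` plays no role. -/
def symKernels (n : ℕ) (s lam Lam : ℝ) : Set (Rn n → ℝ) :=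
  {K | Measurable K ∧
    (∀ z, z ≠ 0 → lam / ‖z‖ ^ ((n : ℝ) + 2 * s) ≤ K z ∧
      K z ≤ Lam / ‖z‖ ^ ((n : ℝ) + 2 * s)) ∧
    ∀ z, z ≠ 0 → K z = K (-z)}

/-- The compensator `1_{2s ∈ [1,2)} 1_B(z) ∇u(x) · z`, with `B` the unit ball (`s < 1` is
assumed wherever this is used). -/
def compensator {n : ℕ} (s : ℝ) (u : Rn n → ℝ) (x z : Rn n) : ℝ :=
  if 1 ≤ 2 * s ∧ ‖z‖ < 1 then fderiv ℝ u x z else 0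

/-- The linear operator
`L_K u(x) = ∫ [u(x+z) - u(x) - 1_{2s ∈ [1,2)} 1_B(z) ∇u(x)·z] K(z) dz`. -/
def linOp {n : ℕ} (s : ℝ) (K : Rn n → ℝ) (u : Rn n → ℝ) (x : Rn n) : ℝ :=
  ∫ z, (u (x + z) - u x - compensator s u x z) * K z

/-- `I` is a translation invariant, positively `1`-homogeneous operator which is elliptic with
respect to `𝒦_sym(lam, Lam)`. The value `I u x` is meaningful for `u ∈ C^{1,1}(x) ∩ L¹(ω_s)`;
nothing is required of it otherwise. -/
structure IsEllipticSym (n : ℕ) (s lam Lam : ℝ) (I : (Rn n → ℝ) → Rn n → ℝ) : Prop where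
  translation : ∀ (u : Rn n → ℝ) (x h : Rn n), C11At u (x + h) → MemL1Weight s u →
    I (fun y => u (y + h)) x = I u (x + h)
  homogeneous : ∀ (u : Rn n → ℝ) (x : Rn n) (t : ℝ), 0 < t → C11At u x → MemL1Weight s u →
    I (fun y => t * u y) x = t * I u x
  elliptic : ∀ (u v : Rn n → ℝ) (x : Rn n),
    C11At u x → MemL1Weight s u → C11At v x → MemL1Weight s v →
    (⨅ K ∈ symKernels n s lam Lam, ((linOp s K u x - linOp s K v x : ℝ) : EReal))
        ≤ ((I u x - I v x : ℝ) : EReal) ∧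
      ((I u x - I v x : ℝ) : EReal)
        ≤ ⨆ K ∈ symKernels n s lam Lam, ((linOp s K u x - linOp s K v x : ℝ) : EReal)

/-- The function equal to `φ` on the ball `B_r(x₀)` and to `u` elsewhere. -/
def testFun {n : ℕ} (u φ : Rn n → ℝ) (x₀ : Rn n) (r : ℝ) (y : Rn n) : ℝ :=
  if dist y x₀ < r then φ y else u y

/-- Viscosity subsolution of `-I u = f(u)` in `ℝⁿ`. The test functions are the
`φ ∈ C²(B_r(x₀))` for which `I` can be evaluated at the glued function, that is, for which
that function is in `L¹(ω_s)` (this only concerns `φ` near the boundary of the ball). -/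
structure IsViscositySubsolution {n : ℕ} (s : ℝ) (I : (Rn n → ℝ) → Rn n → ℝ) (f : ℝ → ℝ)
    (u : Rn n → ℝ) : Prop where
  measurable : Measurable u
  memL1 : MemL1Weight s u
  usc : UpperSemicontinuous u
  test : ∀ (x₀ : Rn n) (r : ℝ) (φ : Rn n → ℝ), 0 < r →
    ContDiffOn ℝ 2 φ (Metric.ball x₀ r) → MemL1Weight s (testFun u φ x₀ r) →
    u x₀ = φ x₀ → (∀ y ∈ Metric.ball x₀ r, u y ≤ φ y) →
    -I (testFun u φ x₀ r) x₀ ≤ f (u x₀)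

/-- Viscosity supersolution of `-I u = f(u)` in `ℝⁿ`. -/
structure IsViscositySupersolution {n : ℕ} (s : ℝ) (I : (Rn n → ℝ) → Rn n → ℝ) (f : ℝ → ℝ)
    (u : Rn n → ℝ) : Prop where
  measurable : Measurable u
  memL1 : MemL1Weight s u
  lsc : LowerSemicontinuous u
  test : ∀ (x₀ : Rn n) (r : ℝ) (φ : Rn n → ℝ), 0 < r →
    ContDiffOn ℝ 2 φ (Metric.ball x₀ r) → MemL1Weight s (testFun u φ x₀ r) →
    u x₀ = φ x₀ → (∀ y ∈ Metric.ball x₀ r, φ y ≤ u y) →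
    f (u x₀) ≤ -I (testFun u φ x₀ r) x₀

/-- Viscosity solution of `-I u = f(u)` in `ℝⁿ`. -/
def IsViscositySolution {n : ℕ} (s : ℝ) (I : (Rn n → ℝ) → Rn n → ℝ) (f : ℝ → ℝ)
    (u : Rn n → ℝ) : Prop :=
  IsViscositySubsolution s I f u ∧ IsViscositySupersolution s I f u

end NonlocalLiouville

end

/-! The proof is a doubling of variables of Ishii–Lions type at a scale `R → ∞`. If `u q < u p`, fix
`A > 0` with `A|p-q|^α < u p - u q` and maximise `u x - u y - A|x-y|^α - B|x-p|²`, where `B` is of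
order `R^(γ-2)`. The growth of `u` keeps the maximiser at `|x-p| < R/2`, and positivity of the
maximum gives `x ≠ y`.

The penalisation supplies a test function from above at `x` and one from below at `y`. By
ellipticity, `f(u y) - f(u x)` is at most the supremum over kernels of an integrated difference of
second differences. Comparing the maximum with the pairs `(x±z, y±z)` leaves only the localisation
and the tail of `u`, both `O(R^(γ-2s))`. For `z` near `(x-y)/2`, moving one point at a time also
exploits the strict concavity of `t ↦ t^α`, which gains a multiple of `t^(α-2s)`, where `t = |x-y|`.
These bounds form `exists_doubling_estimate`.

In case (i), take `γ < α < min 1 (2s)` after making `γ` positive: then `t = O(R^(γ/α)) = o(R)`, so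
`t^(α-2s)` is too large (`false_of_estimate_of_lt`). In case (ii), convexity turns `f(u y) - f(u x)`
into at least `|f'(Q^γ)|` times `u x - u y`, with `Q` comparable to `R`. This term is large for
large `t` and the concavity gain is large for small `t`; balancing them contradicts the limsup
(`false_of_estimate_of_derivative`). -/

namespace NonlocalLiouville

open scoped Pointwise

/-! ### Integrals of powers of the norm on balls and their complements. -/

section Powers

variable {n : ℕ}

theorem integrableOn_ball_norm_rpow [Nonempty (Fin n)] {τ : ℝ} (hτ : -(n : ℝ) < τ) (r : ℝ) :
    IntegrableOn (fun z : Rn n => ‖z‖ ^ τ) (Metric.ball 0 r) := by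
  rcases le_or_gt r 0 with hr | hr
  · simp [Metric.ball_eq_empty.2 hr]
  have hn : 1 ≤ n := Fin.pos_iff_nonempty.2 ‹_›
  rw [← integrable_indicator_iff Metric.isOpen_ball.measurableSet]
  have h1 : (Metric.ball (0 : Rn n) r).indicator (fun z : Rn n => ‖z‖ ^ τ) =
      fun z : Rn n => (Iio r).indicator (fun t : ℝ => t ^ τ) ‖z‖ := by
    ext z
    simp [indicator]
  rw [h1, integrable_fun_norm_addHaar]
  have h2 : IntegrableOn (fun y : ℝ => y ^ ((n : ℝ) - 1 + τ)) (Ioo 0 r) :=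
    (intervalIntegral.integrableOn_Ioo_rpow_iff hr).2 (by linarith)
  rw [← integrable_indicator_iff measurableSet_Ioo] at h2
  rw [← integrable_indicator_iff measurableSet_Ioi]
  refine h2.congr (Eventually.of_forall fun y => ?_)
  simp only [indicator, mem_Ioo, mem_Ioi, mem_Iio, smul_eq_mul]
  by_cases hy : 0 < y
  · by_cases hy' : y < r
    · simp only [hy, hy', and_self, if_true, finrank_euclideanSpace, Fintype.card_fin]
      rw [Real.rpow_add hy, ← Nat.cast_one, ← Nat.cast_sub hn, Real.rpow_natCast]
    · simp [hy, hy']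
  · simp [hy]

theorem integrableOn_compl_ball_norm_rpow [Nonempty (Fin n)] {τ : ℝ} (hτ : τ < -(n : ℝ)) {r : ℝ} (hr : 0 < r) :
    IntegrableOn (fun z : Rn n => ‖z‖ ^ τ) (Metric.ball 0 r)ᶜ := by
  have hn : 1 ≤ n := Fin.pos_iff_nonempty.2 ‹_›
  rw [← integrable_indicator_iff Metric.isOpen_ball.measurableSet.compl]
  have h1 : ((Metric.ball (0 : Rn n) r)ᶜ).indicator (fun z : Rn n => ‖z‖ ^ τ) =
      fun z : Rn n => (Ici r).indicator (fun t : ℝ => t ^ τ) ‖z‖ := by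
    ext z
    simp [indicator]
  rw [h1, integrable_fun_norm_addHaar]
  have h2 : IntegrableOn (fun y : ℝ => y ^ ((n : ℝ) - 1 + τ)) (Ici r) :=
    (integrableOn_Ici_iff_integrableOn_Ioi (by finiteness)).2 ((integrableOn_Ioi_rpow_iff hr).2 (by linarith))
  rw [← integrable_indicator_iff measurableSet_Ici] at h2
  rw [← integrable_indicator_iff measurableSet_Ioi]
  refine h2.congr (Eventually.of_forall fun y => ?_)
  simp only [indicator, mem_Ici, mem_Ioi, smul_eq_mul]
  by_cases hy' : r ≤ y
  · have hy : 0 < y := hr.trans_le hy'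
    simp only [hy, hy', if_true, finrank_euclideanSpace, Fintype.card_fin]
    rw [Real.rpow_add hy, ← Nat.cast_one, ← Nat.cast_sub hn, Real.rpow_natCast]
  · simp [hy']

theorem setIntegral_smul_norm_rpow (S : Set (Rn n)) (τ : ℝ) {r : ℝ}
    (hr : 0 < r) :
    ∫ z in r • S, ‖z‖ ^ τ = r ^ ((n : ℝ) + τ) * ∫ z in S, ‖z‖ ^ τ := by
  have h := Measure.setIntegral_comp_smul_of_pos (volume : Measure (Rn n))
    (fun z : Rn n => ‖z‖ ^ τ) S hr
  have h2 : ∀ z : Rn n, ‖r • z‖ ^ τ = r ^ τ * ‖z‖ ^ τ := fun z => by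
    rw [norm_smul, Real.norm_of_nonneg hr.le, Real.mul_rpow hr.le (norm_nonneg _)]
  simp only [h2, integral_const_mul, finrank_euclideanSpace, Fintype.card_fin, smul_eq_mul] at h
  rw [Real.rpow_add hr, Real.rpow_natCast, mul_assoc, h, ← mul_assoc,
    mul_inv_cancel₀ (pow_ne_zero _ hr.ne'), one_mul]

theorem setIntegral_ball_norm_rpow (τ : ℝ) {r : ℝ} (hr : 0 < r) :
    ∫ z in Metric.ball (0 : Rn n) r, ‖z‖ ^ τ =
      r ^ ((n : ℝ) + τ) * ∫ z in Metric.ball (0 : Rn n) 1, ‖z‖ ^ τ := by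
  rw [← setIntegral_smul_norm_rpow _ _ hr,
    smul_unitBall_of_pos hr]

theorem setIntegral_compl_ball_norm_rpow (τ : ℝ) {r : ℝ} (hr : 0 < r) :
    ∫ z in (Metric.ball (0 : Rn n) r)ᶜ, ‖z‖ ^ τ =
      r ^ ((n : ℝ) + τ) * ∫ z in (Metric.ball (0 : Rn n) 1)ᶜ, ‖z‖ ^ τ := by
  rw [← setIntegral_smul_norm_rpow _ _ hr,
    compl_eq_univ_sdiff, compl_eq_univ_sdiff, smul_set_sdiff₀ hr.ne',
    smul_set_univ₀ hr.ne', smul_unitBall_of_pos hr]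

end Powers

/-! ### The weighted space `L¹(ω_s)`: tails and translations. -/

section Weight

variable {n : ℕ} {s : ℝ}

theorem weight_pos (z : Rn n) : 0 < weight n s z := by
  unfold weight
  positivity

theorem continuous_weight : Continuous (weight n s) := by
  unfold weight
  refine (continuous_const.add continuous_norm).rpow_const fun z => Or.inl ?_
  exact (add_pos_of_pos_of_nonneg one_pos (norm_nonneg z)).ne'

theorem MemL1Weight.aestronglyMeasurable {u : Rn n → ℝ} (hu : MemL1Weight s u) :
    AEStronglyMeasurable u volume := by
  have h : AEStronglyMeasurable (fun z => (u z * weight n s z) * (weight n s z)⁻¹) volume :=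
    AEStronglyMeasurable.mul (Integrable.aestronglyMeasurable hu)
      ((continuous_weight.inv₀ fun z => (weight_pos z).ne').aestronglyMeasurable)
  refine h.congr (Eventually.of_forall fun z => ?_)
  simp [(weight_pos (s := s) z).ne']

theorem memL1Weight_const (hs : 0 < s) (c : ℝ) : MemL1Weight s (fun _ : Rn n => c) := by
  have h : Integrable (fun z : Rn n => (1 + ‖z‖) ^ (-((n : ℝ) + 2 * s))) volume :=
    integrable_one_add_norm (by rw [finrank_euclideanSpace, Fintype.card_fin]; linarith)
  refine (h.const_mul c).congr (Eventually.of_forall fun z => ?_)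
  simp only [weight]
  congr 2
  ring

theorem rpow_neg_le_weight (hs : 0 < s) {r : ℝ} (hr : 0 < r) (x z : Rn n) (hz : r ≤ ‖z‖) :
    ‖z‖ ^ (-((n : ℝ) + 2 * s)) ≤
      (1 + (1 + ‖x‖) / r) ^ ((n : ℝ) + 2 * s) * weight n s (x + z) := by
  have hz0 : 0 < ‖z‖ := hr.trans_le hz
  have hc : 0 ≤ 1 + (1 + ‖x‖) / r := by positivity
  have h1 : 1 + ‖x + z‖ ≤ (1 + (1 + ‖x‖) / r) * ‖z‖ := by
    have h2 : 1 + ‖x‖ ≤ (1 + ‖x‖) / r * ‖z‖ := by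
      rw [div_mul_eq_mul_div, le_div_iff₀ hr]
      exact mul_le_mul_of_nonneg_left hz (by positivity)
    have := norm_add_le x z
    nlinarith
  have hp : 0 ≤ (n : ℝ) + 2 * s := by positivity
  have h3 : (1 + ‖x + z‖) ^ ((n : ℝ) + 2 * s) ≤
      (1 + (1 + ‖x‖) / r) ^ ((n : ℝ) + 2 * s) * ‖z‖ ^ ((n : ℝ) + 2 * s) := by
    rw [← Real.mul_rpow hc hz0.le]
    exact Real.rpow_le_rpow (by positivity) h1 hp
  have h4 : weight n s (x + z) = ((1 + ‖x + z‖) ^ ((n : ℝ) + 2 * s))⁻¹ := by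
    rw [← Real.rpow_neg (by positivity), weight]
    congr 1
    ring
  rw [h4, Real.rpow_neg hz0.le, ← div_eq_mul_inv, le_div_iff₀ (by positivity), inv_mul_eq_div,
    div_le_iff₀ (by positivity)]
  exact h3

theorem integrable_shift_mul_weight {u : Rn n → ℝ} (hu : MemL1Weight s u) (x : Rn n) :
    Integrable (fun z => u (x + z) * weight n s (x + z)) volume :=
  hu.comp_add_left x

theorem MemL1Weight.integrableOn_compl_ball {u : Rn n → ℝ} (hs : 0 < s) (hu : MemL1Weight s u)
    (x : Rn n) {r : ℝ} (hr : 0 < r) :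
    IntegrableOn (fun z => u (x + z) * ‖z‖ ^ (-((n : ℝ) + 2 * s))) (Metric.ball 0 r)ᶜ := by
  have h := ((integrable_shift_mul_weight hu x).norm.const_mul
    ((1 + (1 + ‖x‖) / r) ^ ((n : ℝ) + 2 * s))).integrableOn (s := (Metric.ball 0 r)ᶜ)
  refine Integrable.mono' h ?_ ?_
  · refine AEStronglyMeasurable.mul ?_ ?_
    · exact (hu.aestronglyMeasurable.comp_quasiMeasurePreserving
        (measurePreserving_add_left volume x).quasiMeasurePreserving).restrict
    · exact (measurable_norm.pow_const _).aestronglyMeasurable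
  · refine (ae_restrict_iff' Metric.isOpen_ball.measurableSet.compl).2
      (Eventually.of_forall fun z hz => ?_)
    have hz : r ≤ ‖z‖ := by simpa using hz
    rw [norm_mul, norm_mul, Real.norm_of_nonneg (weight_pos (s := s) (x + z)).le,
      Real.norm_of_nonneg (Real.rpow_nonneg (norm_nonneg z) _), mul_left_comm]
    exact mul_le_mul_of_nonneg_left (rpow_neg_le_weight hs hr x z hz) (norm_nonneg _)

theorem MemL1Weight.comp_add_right {u : Rn n → ℝ} (hs : 0 < s) (hu : MemL1Weight s u)
    (h : Rn n) : MemL1Weight s (fun y => u (y + h)) := by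
  have h1 := (integrable_shift_mul_weight hu h).norm.const_mul
    ((1 + ‖h‖) ^ ((n : ℝ) + 2 * s))
  refine Integrable.mono' h1 ?_ (Eventually.of_forall fun z => ?_)
  · exact (hu.aestronglyMeasurable.comp_quasiMeasurePreserving
      (measurePreserving_add_right volume h).quasiMeasurePreserving).mul
      continuous_weight.aestronglyMeasurable
  · have hp : 0 ≤ (n : ℝ) + 2 * s := by positivity
    have e : ∀ y : Rn n, weight n s y = ((1 + ‖y‖) ^ ((n : ℝ) + 2 * s))⁻¹ := fun y => by
      rw [← Real.rpow_neg (by positivity), weight]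
      congr 1
      ring
    have h2 : weight n s z ≤ (1 + ‖h‖) ^ ((n : ℝ) + 2 * s) * weight n s (h + z) := by
      rw [e, e, ← div_eq_mul_inv, le_div_iff₀ (by positivity), inv_mul_eq_div,
        div_le_iff₀ (by positivity), ← Real.mul_rpow (by positivity) (by positivity)]
      refine Real.rpow_le_rpow (by positivity) ?_ hp
      nlinarith [norm_add_le h z, norm_nonneg h, norm_nonneg z]
    rw [norm_mul, norm_mul, Real.norm_of_nonneg (weight_pos (s := s) z).le,
      Real.norm_of_nonneg (weight_pos (s := s) (h + z)).le, mul_left_comm]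
    simp only [add_comm z h]
    exact mul_le_mul_of_nonneg_left h2 (norm_nonneg _)

end Weight

/-! ### The linear operators and their second-difference form. -/

section LinOp

variable {n : ℕ} {s lam Lam : ℝ}

theorem hasFDerivAt_of_quadratic_bound {u : Rn n → ℝ} {x : Rn n} {p : Rn n →L[ℝ] ℝ} {M r : ℝ}
    (hr : 0 < r) (h : ∀ z : Rn n, ‖z‖ < r → |u (x + z) - u x - p z| ≤ M * ‖z‖ ^ 2) :
    HasFDerivAt u p x := by
  rw [hasFDerivAt_iff_isLittleO_nhds_zero]
  have h1 : (fun z : Rn n => u (x + z) - u x - p z) =O[𝓝 0] fun z => ‖z‖ ^ 2 := by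
    refine Asymptotics.IsBigO.of_bound M ?_
    filter_upwards [Metric.ball_mem_nhds (0 : Rn n) hr] with z hz
    simpa using h z (by simpa using hz)
  exact h1.trans_isLittleO (Asymptotics.isLittleO_norm_pow_id one_lt_two)

theorem kernel_bounds {K : Rn n → ℝ} (hK : K ∈ symKernels n s lam Lam) {z : Rn n}
    (hz : z ≠ 0) :
    lam * ‖z‖ ^ (-((n : ℝ) + 2 * s)) ≤ K z ∧ K z ≤ Lam * ‖z‖ ^ (-((n : ℝ) + 2 * s)) := by
  simpa only [Real.rpow_neg (norm_nonneg z), div_eq_mul_inv] using hK.2.1 z hz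

theorem kernel_nonneg {K : Rn n → ℝ} (hlam : 0 < lam) (hK : K ∈ symKernels n s lam Lam)
    {z : Rn n} (hz : z ≠ 0) : 0 ≤ K z :=
  le_trans (by positivity) (kernel_bounds hK hz).1

theorem kernel_neg {K : Rn n → ℝ} (hK : K ∈ symKernels n s lam Lam) (z : Rn n) :
    K (-z) = K z := by
  by_cases hz : z = 0
  · simp [hz]
  · exact (hK.2.2 z hz).symm

theorem measurable_compensator (u : Rn n → ℝ) (x : Rn n) : Measurable (compensator s u x) := by
  unfold compensator
  refine Measurable.ite ?_ (ContinuousLinearMap.continuous _).measurable measurable_const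
  by_cases h : 1 ≤ 2 * s
  · simpa [h] using measurableSet_lt measurable_norm measurable_const
  · simp [h]

theorem compensator_neg (u : Rn n → ℝ) (x z : Rn n) :
    compensator s u x (-z) = -compensator s u x z := by
  unfold compensator
  rw [norm_neg]
  split_ifs <;> simp

theorem integrable_linOp_integrand [Nonempty (Fin n)] (hs0 : 0 < s) (hs1 : s < 1)
    (hlam : 0 < lam) {K : Rn n → ℝ} (hK : K ∈ symKernels n s lam Lam) {u : Rn n → ℝ}
    {x : Rn n} (hu : C11At u x) (huw : MemL1Weight s u) :
    Integrable (fun z => (u (x + z) - u x - compensator s u x z) * K z) volume := by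
  obtain ⟨p, M, r, hr, h⟩ := hu
  have hp : fderiv ℝ u x = p := (hasFDerivAt_of_quadratic_bound hr h).fderiv
  have hmeas : AEStronglyMeasurable
      (fun z => (u (x + z) - u x - compensator s u x z) * K z) volume := by
    refine AEStronglyMeasurable.mul (AEStronglyMeasurable.sub (AEStronglyMeasurable.sub ?_
      aestronglyMeasurable_const) ?_) hK.1.aestronglyMeasurable
    · exact huw.aestronglyMeasurable.comp_quasiMeasurePreserving
        (measurePreserving_add_left volume x).quasiMeasurePreserving
    · exact (measurable_compensator u x).aestronglyMeasurable
  have hLK : ∀ z : Rn n, z ≠ 0 → |K z| ≤ Lam * ‖z‖ ^ (-((n : ℝ) + 2 * s)) := fun z hz => by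
    rw [abs_of_nonneg (kernel_nonneg hlam hK hz)]
    exact (kernel_bounds hK hz).2
  -- Near the origin the integrand is quadratic once the gradient is subtracted; when `2s < 1`
  -- nothing is subtracted, and linear decay already beats the singularity.
  obtain ⟨τ, C, hτ, hC⟩ : ∃ τ C : ℝ, 2 * s < τ ∧ ∀ z : Rn n, z ≠ 0 → ‖z‖ < min r 1 →
      |u (x + z) - u x - compensator s u x z| ≤ C * ‖z‖ ^ τ := by
    by_cases h2 : 1 ≤ 2 * s
    · refine ⟨2, M, by linarith, fun z hz hzr => ?_⟩
      have h3 : compensator s u x z = p z := by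
        simp [compensator, h2, lt_of_lt_of_le hzr (min_le_right _ _), hp]
      rw [h3, Real.rpow_ofNat]
      exact h z (lt_of_lt_of_le hzr (min_le_left _ _))
    · refine ⟨1, |M| + ‖p‖, by linarith, fun z hz hzr => ?_⟩
      have h3 : compensator s u x z = 0 := by simp [compensator, h2]
      rw [h3, Real.rpow_one, sub_zero]
      have h4 := h z (lt_of_lt_of_le hzr (min_le_left _ _))
      have h5 : ‖p z‖ ≤ ‖p‖ * ‖z‖ := p.le_opNorm z
      have h6 : M * ‖z‖ ^ 2 ≤ |M| * ‖z‖ := by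
        have : ‖z‖ ^ 2 ≤ ‖z‖ := by
          have := lt_of_lt_of_le hzr (min_le_right _ _)
          nlinarith [norm_nonneg z]
        calc M * ‖z‖ ^ 2 ≤ |M| * ‖z‖ ^ 2 :=
              mul_le_mul_of_nonneg_right (le_abs_self M) (by positivity)
          _ ≤ |M| * ‖z‖ := mul_le_mul_of_nonneg_left this (abs_nonneg M)
      calc |u (x + z) - u x| = |(u (x + z) - u x - p z) + p z| := by ring_nf
        _ ≤ |u (x + z) - u x - p z| + |p z| := abs_add_le _ _
        _ ≤ (|M| + ‖p‖) * ‖z‖ := by rw [Real.norm_eq_abs] at h5; linarith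
  have hr1 : 0 < min r 1 := lt_min hr one_pos
  have hball : MeasurableSet (Metric.ball (0 : Rn n) (min r 1)) :=
    Metric.isOpen_ball.measurableSet
  have hne : ∀ᵐ z : Rn n, z ≠ 0 := by
    simp [ae_iff]
  have hin : IntegrableOn (fun z => (u (x + z) - u x - compensator s u x z) * K z)
      (Metric.ball 0 (min r 1)) volume := by
    refine Integrable.mono' ((integrableOn_ball_norm_rpow
      (τ := τ - ((n : ℝ) + 2 * s)) (by linarith) (min r 1)).const_mul (C * Lam)) hmeas.restrict ?_
    refine (ae_restrict_iff' hball).2 ?_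
    filter_upwards [hne] with z hz hzr
    have hzr : ‖z‖ < min r 1 := by simpa using hzr
    have hz0 : 0 < ‖z‖ := norm_pos_iff.2 hz
    rw [norm_mul, Real.norm_eq_abs, Real.norm_eq_abs, sub_eq_add_neg τ, Real.rpow_add hz0,
      mul_mul_mul_comm]
    exact mul_le_mul (hC z hz hzr) (hLK z hz) (abs_nonneg _) ((abs_nonneg _).trans (hC z hz hzr))
  have hout : IntegrableOn (fun z => (u (x + z) - u x - compensator s u x z) * K z)
      (Metric.ball 0 (min r 1))ᶜ volume := by
    have i1 := (huw.integrableOn_compl_ball hs0 x hr1).norm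
    have i2 := integrableOn_compl_ball_norm_rpow (n := n)
      (τ := -((n : ℝ) + 2 * s)) (by linarith) hr1
    refine Integrable.mono' ((i1.add (i2.const_mul (|u x| + ‖p‖))).const_mul Lam)
      hmeas.restrict ?_
    refine (ae_restrict_iff' hball.compl).2 ?_
    filter_upwards [hne] with z hz _
    have h3 : |compensator s u x z| ≤ ‖p‖ := by
      unfold compensator
      split_ifs with hc
      · rw [hp, ← Real.norm_eq_abs]
        exact (p.le_opNorm z).trans (mul_le_of_le_one_right (norm_nonneg p) hc.2.le)
      · simp
    have h4 : |u (x + z) - u x - compensator s u x z| ≤ |u (x + z)| + (|u x| + ‖p‖) := by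
      have h5 := abs_sub (u (x + z) - u x) (compensator s u x z)
      have h6 := abs_sub (u (x + z)) (u x)
      linarith
    rw [norm_mul, Real.norm_eq_abs, Real.norm_eq_abs]
    refine (mul_le_mul h4 (hLK z hz) (abs_nonneg _) (by positivity)).trans (le_of_eq ?_)
    simp only [Pi.add_apply, norm_mul, Real.norm_eq_abs,
      abs_of_nonneg (Real.rpow_nonneg (norm_nonneg z) (-((n : ℝ) + 2 * s)))]
    ring
  have := hin.union hout
  rwa [union_compl_self, integrableOn_univ] at this

/-- Second order difference. -/
def secondDiff (u : Rn n → ℝ) (x z : Rn n) : ℝ := u (x + z) + u (x - z) - 2 * u x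

/-- Averaging the integrand over `z` and `-z` cancels the odd compensator, because the kernel is
even. From here on gradients play no role. -/
theorem integrable_secondDiff_mul_kernel [Nonempty (Fin n)] (hs0 : 0 < s) (hs1 : s < 1)
    (hlam : 0 < lam) {K : Rn n → ℝ} (hK : K ∈ symKernels n s lam Lam) {u : Rn n → ℝ}
    {x : Rn n} (hu : C11At u x) (huw : MemL1Weight s u) :
    Integrable (fun z => secondDiff u x z * K z) volume ∧
      2 * linOp s K u x = ∫ z, secondDiff u x z * K z := by
  have h := integrable_linOp_integrand hs0 hs1 hlam hK hu huw
  have h' := h.comp_neg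
  have e : ∀ z, secondDiff u x z * K z = (u (x + z) - u x - compensator s u x z) * K z +
      (u (x + -z) - u x - compensator s u x (-z)) * K (-z) := fun z => by
    rw [kernel_neg hK, compensator_neg, secondDiff, ← sub_eq_add_neg]
    ring
  simp only [e]
  refine ⟨h.add h', ?_⟩
  rw [integral_add h h', integral_neg_eq_self
    (fun z => (u (x + z) - u x - compensator s u x z) * K z), linOp, two_mul]

end LinOp

/-! ### Regularity and integrability of glued test functions. -/

section TestFunctions

variable {n : ℕ} {s : ℝ}

theorem c11At_of_contDiffAt {u : Rn n → ℝ} {x : Rn n} (hu : ContDiffAt ℝ 2 u x) :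
    C11At u x := by
  have h1 : ContDiffAt ℝ 1 (fderiv ℝ u) x := hu.fderiv_right (by norm_num)
  obtain ⟨L, t, ht, hL⟩ := h1.exists_lipschitzOnWith
  have h2 : ∀ᶠ y in 𝓝 x, DifferentiableAt ℝ u y :=
    (hu.eventually (by simp)).mono fun y hy => hy.differentiableAt (by norm_num)
  obtain ⟨r, hr, hrt⟩ := Metric.mem_nhds_iff.1 (inter_mem ht h2)
  refine ⟨fderiv ℝ u x, L, r, hr, fun z hz => ?_⟩
  have hsub : Metric.closedBall x ‖z‖ ⊆ Metric.ball x r := Metric.closedBall_subset_ball hz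
  have h3 := Convex.norm_image_sub_le_of_norm_hasFDerivWithin_le' (f := u)
    (f' := fderiv ℝ u) (φ := fderiv ℝ u x) (s := Metric.closedBall x ‖z‖) (x := x) (y := x + z)
    (C := L * ‖z‖) (fun y hy => (hrt (hsub hy)).2.hasFDerivAt.hasFDerivWithinAt)
    (fun y hy => ?_) (convex_closedBall x _) (by simp) (by simp)
  · rw [add_sub_cancel_left, Real.norm_eq_abs] at h3
    calc _ ≤ _ := h3
      _ = L * ‖z‖ ^ 2 := by ring
  · have := hL.dist_le_mul y (hrt (hsub hy)).1 x (mem_of_mem_nhds ht)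
    rw [dist_eq_norm, dist_eq_norm] at this
    refine this.trans (mul_le_mul_of_nonneg_left ?_ L.2)
    simpa [dist_eq_norm] using hy

theorem C11At.congr {u v : Rn n → ℝ} {x : Rn n} (hu : C11At u x) (h : v =ᶠ[𝓝 x] u) :
    C11At v x := by
  obtain ⟨p, M, r, hr, hM⟩ := hu
  obtain ⟨r', hr', h'⟩ := Metric.eventually_nhds_iff.1 h
  refine ⟨p, M, min r r', lt_min hr hr', fun z hz => ?_⟩
  rw [h.eq_of_nhds, h' (by simpa using lt_of_lt_of_le hz (min_le_right _ _))]
  exact hM z (lt_of_lt_of_le hz (min_le_left _ _))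

theorem C11At.comp_add_right {u : Rn n → ℝ} {x h : Rn n} (hu : C11At u (x + h)) :
    C11At (fun y => u (y + h)) x := by
  obtain ⟨p, M, r, hr, hM⟩ := hu
  refine ⟨p, M, r, hr, fun z hz => ?_⟩
  have := hM z hz
  rwa [add_right_comm] at this

theorem testFun_of_lt {u φ : Rn n → ℝ} {x y : Rn n} {r : ℝ} (h : dist y x < r) :
    testFun u φ x r y = φ y := if_pos h

theorem testFun_of_le {u φ : Rn n → ℝ} {x y : Rn n} {r : ℝ} (h : r ≤ dist y x) :
    testFun u φ x r y = u y := if_neg h.not_gt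

theorem c11At_testFun {u φ : Rn n → ℝ} {x : Rn n} {r : ℝ} (hr : 0 < r)
    (hφ : ContDiffOn ℝ 2 φ (Metric.ball x r)) : C11At (testFun u φ x r) x := by
  refine (c11At_of_contDiffAt (hφ.contDiffAt (Metric.ball_mem_nhds x hr))).congr ?_
  filter_upwards [Metric.ball_mem_nhds x hr] with y hy
  exact testFun_of_lt hy

theorem memL1Weight_testFun (hs : 0 < s) {u φ : Rn n → ℝ} (hu : MemL1Weight s u)
    (hφ : Continuous φ) (x : Rn n) (r : ℝ) : MemL1Weight s (testFun u φ x r) := by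
  obtain ⟨C, hC⟩ := (isCompact_closedBall x r).exists_bound_of_continuousOn hφ.continuousOn
  have h1 := (Integrable.norm hu).add (Integrable.norm (memL1Weight_const (n := n) hs C))
  refine Integrable.mono' h1 ?_ (Eventually.of_forall fun z => ?_)
  · classical
    refine AEStronglyMeasurable.mul ?_ continuous_weight.aestronglyMeasurable
    have : testFun u φ x r = (Metric.ball x r).piecewise φ u := by
      ext y
      simp [testFun, piecewise]
    rw [this]
    exact AEStronglyMeasurable.piecewise Metric.isOpen_ball.measurableSet
      hφ.aestronglyMeasurable.restrict hu.aestronglyMeasurable.restrict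
  · simp only [Pi.add_apply, norm_mul, ← add_mul]
    refine mul_le_mul_of_nonneg_right ?_ (norm_nonneg _)
    rcases lt_or_ge (dist z x) r with hz | hz
    · rw [testFun_of_lt hz]
      have := (hC z (Metric.mem_closedBall.2 hz.le)).trans (Real.le_norm_self C)
      linarith [norm_nonneg (u z)]
    · rw [testFun_of_le hz]
      linarith [norm_nonneg C]

end TestFunctions

/-! ### Concavity of the profile `|a|^α`. -/

section Profile

variable {n : ℕ} {α : ℝ}

/-- Write `|x|^α = (|x|²)^(α/2)`: concavity and the parallelogram law reduce the sum to `(|a|² +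
|z|²)^(α/2)`, and Bernoulli's inequality finishes. No smallness of `z` is needed. -/
theorem norm_rpow_secondDiff_le (h0 : 0 < α) (h1 : α < 1) {a : Rn n} (ha : a ≠ 0) (z : Rn n) :
    ‖a + z‖ ^ α + ‖a - z‖ ^ α - 2 * ‖a‖ ^ α ≤ α * ‖a‖ ^ (α - 2) * ‖z‖ ^ 2 := by
  have ha0 : 0 < ‖a‖ := norm_pos_iff.2 ha
  have hsq : ∀ x : Rn n, ‖x‖ ^ α = (‖x‖ ^ 2) ^ (α / 2) := fun x => by
    rw [← Real.rpow_natCast, ← Real.rpow_mul (norm_nonneg x)]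
    congr 1
    push_cast
    ring
  have hc := (Real.concaveOn_rpow (p := α / 2) (by linarith) (by linarith)).2
    (mem_Ici.2 (sq_nonneg ‖a + z‖)) (mem_Ici.2 (sq_nonneg ‖a - z‖))
    (by norm_num : (0 : ℝ) ≤ 1 / 2) (by norm_num : (0 : ℝ) ≤ 1 / 2) (by norm_num)
  have hpar : ‖a + z‖ ^ 2 + ‖a - z‖ ^ 2 = 2 * (‖a‖ ^ 2 + ‖z‖ ^ 2) := by
    have := parallelogram_law_with_norm ℝ a z
    nlinarith
  simp only [smul_eq_mul] at hc
  rw [← hsq, ← hsq, ← mul_add, ← mul_add, hpar] at hc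
  have he : (1 / 2 : ℝ) * (2 * (‖a‖ ^ 2 + ‖z‖ ^ 2)) = ‖a‖ ^ 2 * (1 + ‖z‖ ^ 2 / ‖a‖ ^ 2) := by
    field_simp
  rw [he, Real.mul_rpow (by positivity) (by positivity), ← hsq] at hc
  have hb := rpow_one_add_le_one_add_mul_self (s := ‖z‖ ^ 2 / ‖a‖ ^ 2) (p := α / 2)
    (le_trans (by norm_num) (div_nonneg (sq_nonneg _) (sq_nonneg _))) (by linarith) (by linarith)
  have hm := mul_le_mul_of_nonneg_left hb (Real.rpow_nonneg ha0.le α)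
  have h2 : ‖a‖ ^ (α - 2) = ‖a‖ ^ α / ‖a‖ ^ 2 := by
    rw [Real.rpow_sub ha0, Real.rpow_ofNat]
  rw [h2]
  have h3 : α * (‖a‖ ^ α / ‖a‖ ^ 2) * ‖z‖ ^ 2 =
    2 * (‖a‖ ^ α * (1 + α / 2 * (‖z‖ ^ 2 / ‖a‖ ^ 2)) - ‖a‖ ^ α) := by ring
  rw [h3]
  linarith

/-- At `z = a/2` the two norms are `3/2` and `1/2` times `|a|`, and strict concavity gives `(3/2)^α
+ (1/2)^α < 2`. Continuity preserves half of the gap on a ball of proportional radius; `η < 1/4`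
keeps that ball away from the origin. -/
theorem exists_profile_gain (h0 : 0 < α) (h1 : α < 1) :
    ∃ η c : ℝ, 0 < η ∧ η < 1 / 4 ∧ 0 < c ∧ ∀ (n : ℕ) (a z : Rn n),
      ‖z - (1 / 2 : ℝ) • a‖ < η * ‖a‖ →
        ‖a + z‖ ^ α + ‖a - z‖ ^ α - 2 * ‖a‖ ^ α ≤ -c * ‖a‖ ^ α := by
  have hs := (Real.strictConcaveOn_rpow h0 h1).2
    (mem_Ici.2 (by norm_num : (0 : ℝ) ≤ 3 / 2)) (mem_Ici.2 (by norm_num : (0 : ℝ) ≤ 1 / 2))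
    (by norm_num) (by norm_num : (0 : ℝ) < 1 / 2) (by norm_num : (0 : ℝ) < 1 / 2) (by norm_num)
  simp only [smul_eq_mul] at hs
  rw [(by norm_num : (1 / 2 * (3 / 2) + 1 / 2 * (1 / 2) : ℝ) = 1), Real.one_rpow] at hs
  set c : ℝ := 2 - ((3 / 2 : ℝ) ^ α + (1 / 2 : ℝ) ^ α) with hc
  have hc0 : 0 < c := by linarith
  have hcont : ContinuousAt (fun t : ℝ => (3 / 2 + t) ^ α + (1 / 2 + t) ^ α) 0 := by
    refine ContinuousAt.add ?_ ?_ <;>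
    · refine ContinuousAt.rpow_const (by fun_prop) (Or.inl (by norm_num))
  have hev : ∀ᶠ t in 𝓝 (0 : ℝ), (3 / 2 + t) ^ α + (1 / 2 + t) ^ α < 2 - c / 2 := by
    refine hcont.eventually_lt continuousAt_const ?_
    simp only [add_zero]
    linarith
  obtain ⟨η, ⟨hη, hη1⟩, hη0⟩ := (((hev.and (gt_mem_nhds (by norm_num : (0 : ℝ) < 1 / 4))).filter_mono
    nhdsWithin_le_nhds).and (self_mem_nhdsWithin (s := Ioi (0 : ℝ)))).exists
  refine ⟨η, c / 2, hη0, hη1, by linarith, fun n a z hz => ?_⟩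
  have e1 : ‖a + z‖ ≤ (3 / 2 + η) * ‖a‖ := by
    have : a + z = (3 / 2 : ℝ) • a + (z - (1 / 2 : ℝ) • a) := by module
    rw [this]
    refine (norm_add_le _ _).trans ?_
    rw [norm_smul, Real.norm_of_nonneg (by norm_num)]
    linarith
  have e2 : ‖a - z‖ ≤ (1 / 2 + η) * ‖a‖ := by
    have : a - z = (1 / 2 : ℝ) • a - (z - (1 / 2 : ℝ) • a) := by module
    rw [this]
    refine (norm_sub_le _ _).trans ?_
    rw [norm_smul, Real.norm_of_nonneg (by norm_num)]
    linarith
  have f1 := Real.rpow_le_rpow (norm_nonneg _) e1 h0.le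
  have f2 := Real.rpow_le_rpow (norm_nonneg _) e2 h0.le
  rw [Real.mul_rpow (by linarith) (norm_nonneg _)] at f1 f2
  have := mul_le_mul_of_nonneg_right hη.le (Real.rpow_nonneg (norm_nonneg a) α)
  nlinarith

end Profile

/-! ### Ellipticity between two points and kernel-uniform integral bounds. -/

variable {n : ℕ} {s lam Lam : ℝ}

/-- Ellipticity compares two functions at one point; translation invariance moves `V` from `y` to
`x`. The same kernel then acts on both second differences, so they may be subtracted before
integrating. -/
theorem IsEllipticSym.sub_le [Nonempty (Fin n)] {I : (Rn n → ℝ) → Rn n → ℝ}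
    (hI : IsEllipticSym n s lam Lam I) (hs0 : 0 < s) (hs1 : s < 1) (hlam : 0 < lam)
    {U V : Rn n → ℝ} {x y : Rn n} (hU : C11At U x) (hUw : MemL1Weight s U)
    (hV : C11At V y) (hVw : MemL1Weight s V) {E : ℝ}
    (hE : ∀ K ∈ symKernels n s lam Lam,
      Integrable (fun z => (secondDiff U x z - secondDiff V y z) * K z) volume →
      ∫ z, (secondDiff U x z - secondDiff V y z) * K z ≤ 2 * E) :
    I U x - I V y ≤ E := by
  have hxy : x + (y - x) = y := by abel
  have hV' : C11At (fun w => V (w + (y - x))) x := C11At.comp_add_right (by rwa [hxy])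
  have hVw' := hVw.comp_add_right hs0 (y - x)
  have ht : I (fun w => V (w + (y - x))) x = I V y := by
    rw [hI.translation V x (y - x) (by rwa [hxy]) hVw, hxy]
  have hd : ∀ z, secondDiff (fun w => V (w + (y - x))) x z = secondDiff V y z := fun z => by
    have d1 : x + z + (y - x) = y + z := by abel
    have d2 : x - z + (y - x) = y - z := by abel
    simp only [secondDiff, d1, d2, hxy]
  have h := (hI.elliptic U _ x hU hUw hV' hVw').2
  rw [ht] at h
  refine EReal.coe_le_coe_iff.1 (h.trans (iSup₂_le fun K hK => EReal.coe_le_coe_iff.2 ?_))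
  obtain ⟨i1, e1⟩ := integrable_secondDiff_mul_kernel hs0 hs1 hlam hK hU hUw
  obtain ⟨i2, e2⟩ := integrable_secondDiff_mul_kernel hs0 hs1 hlam hK hV' hVw'
  simp only [hd] at i2 e2
  have i3 := i1.sub i2
  have e3 : (fun z => (secondDiff U x z - secondDiff V y z) * K z) =
      (fun z => secondDiff U x z * K z) - fun z => secondDiff V y z * K z := by
    ext z
    simp [sub_mul]
  have h4 := hE K hK (by rwa [e3])
  rw [e3, integral_sub' i1 i2] at h4
  linarith

/-- The nonnegative error is paired with the upper kernel bound and the negative gain with the lower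
one, so the result is uniform in `K`. -/
theorem integral_mul_kernel_le [Nonempty (Fin n)] (hlam : 0 < lam) {K : Rn n → ℝ}
    (hK : K ∈ symKernels n s lam Lam) {W P : Rn n → ℝ} {S : Set (Rn n)} {c : ℝ}
    (hS : MeasurableSet S) (hc : 0 ≤ c) (hP : ∀ z, 0 ≤ P z)
    (hW : ∀ z, W z ≤ P z - S.indicator (fun _ => c) z)
    (hWi : Integrable (fun z => W z * K z) volume)
    (hPi : Integrable (fun z => P z * ‖z‖ ^ (-((n : ℝ) + 2 * s))) volume)
    (hSi : IntegrableOn (fun z : Rn n => ‖z‖ ^ (-((n : ℝ) + 2 * s))) S volume) :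
    ∫ z, W z * K z ≤ Lam * (∫ z, P z * ‖z‖ ^ (-((n : ℝ) + 2 * s))) -
      lam * c * ∫ z in S, ‖z‖ ^ (-((n : ℝ) + 2 * s)) := by
  rw [← integral_indicator hS, ← integral_const_mul, ← integral_const_mul,
    ← integral_sub (hPi.const_mul _) (((integrable_indicator_iff hS).2 hSi).const_mul _)]
  refine integral_mono_ae hWi
    ((hPi.const_mul _).sub (((integrable_indicator_iff hS).2 hSi).const_mul _)) ?_
  have hne : ∀ᵐ z : Rn n, z ≠ 0 := by simp [ae_iff]
  filter_upwards [hne] with z hz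
  obtain ⟨h1, h2⟩ := kernel_bounds hK hz
  refine (mul_le_mul_of_nonneg_right (hW z) (kernel_nonneg hlam hK hz)).trans ?_
  rw [sub_mul]
  have h3 := mul_le_mul_of_nonneg_left h2 (hP z)
  by_cases hzS : z ∈ S
  · simp only [indicator_of_mem hzS]
    have h4 := mul_le_mul_of_nonneg_left h1 hc
    linarith
  · simp only [indicator_of_notMem hzS]
    linarith

/-- The function `|z|² 1_{|z| < r}`. -/
noncomputable def truncSq (r : ℝ) (z : Rn n) : ℝ := (Metric.ball (0 : Rn n) r).indicator (fun z => ‖z‖ ^ 2) z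

theorem truncSq_nonneg (r : ℝ) (z : Rn n) : 0 ≤ truncSq r z :=
  indicator_nonneg (fun _ _ => by positivity) z

theorem truncSq_of_lt {r : ℝ} {z : Rn n} (h : ‖z‖ < r) : truncSq r z = ‖z‖ ^ 2 :=
  indicator_of_mem (by simpa using h) _

theorem integral_truncSq [Nonempty (Fin n)] (hs1 : s < 1) {r : ℝ} (hr : 0 < r) :
    Integrable (fun z : Rn n => truncSq r z * ‖z‖ ^ (-((n : ℝ) + 2 * s))) volume ∧
    ∫ z : Rn n, truncSq r z * ‖z‖ ^ (-((n : ℝ) + 2 * s)) =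
      r ^ (2 - 2 * s) * ∫ z in Metric.ball (0 : Rn n) 1, ‖z‖ ^ (2 - ((n : ℝ) + 2 * s)) := by
  have hb : MeasurableSet (Metric.ball (0 : Rn n) r) := Metric.isOpen_ball.measurableSet
  have hi := integrableOn_ball_norm_rpow (n := n) (τ := 2 - ((n : ℝ) + 2 * s)) (by linarith) r
  have hne : ∀ᵐ z : Rn n, z ≠ 0 := by simp [ae_iff]
  have he : (fun z : Rn n => truncSq r z * ‖z‖ ^ (-((n : ℝ) + 2 * s))) =ᵐ[volume]
      (Metric.ball (0 : Rn n) r).indicator fun z => ‖z‖ ^ (2 - ((n : ℝ) + 2 * s)) := by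
    filter_upwards [hne] with z hz
    by_cases hz' : z ∈ Metric.ball (0 : Rn n) r
    · rw [indicator_of_mem hz', truncSq, indicator_of_mem hz', sub_eq_add_neg,
        Real.rpow_add (norm_pos_iff.2 hz), Real.rpow_ofNat]
    · rw [indicator_of_notMem hz', truncSq, indicator_of_notMem hz', zero_mul]
  refine ⟨((integrable_indicator_iff hb).2 hi).congr he.symm, ?_⟩
  rw [integral_congr_ae he, integral_indicator hb, setIntegral_ball_norm_rpow _ hr]
  congr 2
  ring

/-- The tail `u(x+z) 1_{|z| ≥ r}`. -/
noncomputable def tail (u : Rn n → ℝ) (x : Rn n) (r : ℝ) (z : Rn n) : ℝ :=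
  ((Metric.ball (0 : Rn n) r)ᶜ).indicator (fun z => u (x + z)) z

theorem tail_nonneg {u : Rn n → ℝ} (hu : ∀ x, 0 < u x) (x : Rn n) (r : ℝ) (z : Rn n) :
    0 ≤ tail u x r z :=
  indicator_nonneg (fun _ _ => (hu _).le) z

theorem tail_of_le {u : Rn n → ℝ} {x : Rn n} {r : ℝ} {z : Rn n} (h : r ≤ ‖z‖) :
    tail u x r z = u (x + z) :=
  indicator_of_mem (by simpa using h) _

theorem integral_tail {u : Rn n → ℝ} (hs0 : 0 < s) (huw : MemL1Weight s u) (x : Rn n) {r : ℝ}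
    (hr : 0 < r) :
    Integrable (fun z : Rn n => tail u x r z * ‖z‖ ^ (-((n : ℝ) + 2 * s))) volume ∧
    ∫ z : Rn n, tail u x r z * ‖z‖ ^ (-((n : ℝ) + 2 * s)) =
      ∫ z in (Metric.ball (0 : Rn n) r)ᶜ, u (x + z) * ‖z‖ ^ (-((n : ℝ) + 2 * s)) := by
  have hb : MeasurableSet (Metric.ball (0 : Rn n) r)ᶜ := Metric.isOpen_ball.measurableSet.compl
  have he : (fun z : Rn n => tail u x r z * ‖z‖ ^ (-((n : ℝ) + 2 * s))) =
      ((Metric.ball (0 : Rn n) r)ᶜ).indicator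
        fun z => u (x + z) * ‖z‖ ^ (-((n : ℝ) + 2 * s)) := by
    ext z
    by_cases hz' : z ∈ (Metric.ball (0 : Rn n) r)ᶜ
    · rw [indicator_of_mem hz', tail, indicator_of_mem hz']
    · rw [indicator_of_notMem hz', tail, indicator_of_notMem hz', zero_mul]
  rw [he, integral_indicator hb, integrable_indicator_iff hb]
  exact ⟨huw.integrableOn_compl_ball hs0 x hr, rfl⟩

/-! ### Viscosity inequalities at a doubling maximum. -/

/-- `(x, y)` maximises the doubled function `u(x) - u(y) - A|x-y|^α - B|x-p|²` over
`x` in the closed ball of radius `R` around `p` and all `y`. -/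
def IsDoublingMax (u : Rn n → ℝ) (α A B R : ℝ) (p x y : Rn n) : Prop :=
  ∀ x' y' : Rn n, ‖x' - p‖ ≤ R →
    u x' - u y' - A * ‖x' - y'‖ ^ α - B * ‖x' - p‖ ^ 2 ≤
      u x - u y - A * ‖x - y‖ ^ α - B * ‖x - p‖ ^ 2

/-- Test function from above at the first doubling point. -/
noncomputable def upperTest (u : Rn n → ℝ) (α A B : ℝ) (p x y w : Rn n) : ℝ :=
  A * ‖w - y‖ ^ α + B * ‖w - p‖ ^ 2 + (u x - A * ‖x - y‖ ^ α - B * ‖x - p‖ ^ 2)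

/-- Test function from below at the second doubling point. -/
noncomputable def lowerTest (u : Rn n → ℝ) (α A : ℝ) (x y w : Rn n) : ℝ :=
  u y + A * ‖x - y‖ ^ α - A * ‖x - w‖ ^ α

theorem continuous_upperTest (u : Rn n → ℝ) {α : ℝ} (hα : 0 < α) (A B : ℝ) (p x y : Rn n) :
    Continuous (upperTest u α A B p x y) := by
  unfold upperTest
  have : Continuous fun w : Rn n => ‖w - y‖ ^ α :=
    Continuous.rpow_const (by fun_prop) fun _ => Or.inr hα.le
  fun_prop

theorem continuous_lowerTest (u : Rn n → ℝ) {α : ℝ} (hα : 0 < α) (A : ℝ) (x y : Rn n) :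
    Continuous (lowerTest u α A x y) := by
  unfold lowerTest
  have : Continuous fun w : Rn n => ‖x - w‖ ^ α :=
    Continuous.rpow_const (by fun_prop) fun _ => Or.inr hα.le
  fun_prop

theorem contDiffOn_upperTest (u : Rn n → ℝ) (α A B : ℝ) (p x y : Rn n) {ρ : ℝ}
    (hρ : ρ ≤ ‖x - y‖) : ContDiffOn ℝ 2 (upperTest u α A B p x y) (Metric.ball x ρ) := by
  have h1 : ContDiffOn ℝ 2 (fun w : Rn n => ‖w - y‖ ^ α) (Metric.ball x ρ) := by
    intro w hw
    have hw : w - y ≠ 0 := fun h => by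
      rw [sub_eq_zero] at h
      rw [h, Metric.mem_ball, dist_comm, dist_eq_norm] at hw
      linarith
    exact (((contDiffAt_id.sub contDiffAt_const).norm ℝ hw).rpow_const_of_ne
      (norm_ne_zero_iff.2 hw)).contDiffWithinAt
  have h2 : ContDiff ℝ 2 fun w : Rn n => ‖w - p‖ ^ 2 :=
    (contDiff_id.sub contDiff_const).norm_sq ℝ
  unfold upperTest
  exact ((contDiffOn_const.mul h1).add (contDiffOn_const.mul h2.contDiffOn)).add
    contDiffOn_const

theorem contDiffOn_lowerTest (u : Rn n → ℝ) (α A : ℝ) (x y : Rn n) {ρ : ℝ}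
    (hρ : ρ ≤ ‖x - y‖) : ContDiffOn ℝ 2 (lowerTest u α A x y) (Metric.ball y ρ) := by
  have h1 : ContDiffOn ℝ 2 (fun w : Rn n => ‖x - w‖ ^ α) (Metric.ball y ρ) := by
    intro w hw
    have hw : x - w ≠ 0 := fun h => by
      rw [sub_eq_zero] at h
      rw [← h, Metric.mem_ball, dist_eq_norm] at hw
      linarith
    exact (((contDiffAt_const.sub contDiffAt_id).norm ℝ hw).rpow_const_of_ne
      (norm_ne_zero_iff.2 hw)).contDiffWithinAt
  unfold lowerTest
  exact contDiffOn_const.sub (contDiffOn_const.mul h1)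

theorem norm_sq_add_add_norm_sq_sub (q z : Rn n) :
    ‖q + z‖ ^ 2 + ‖q - z‖ ^ 2 = 2 * ‖q‖ ^ 2 + 2 * ‖z‖ ^ 2 := by
  have := parallelogram_law_with_norm ℝ q z
  nlinarith

/-- Three regimes in `|z|`: below `ρ` the glued functions are the test functions, between `ρ` and
`R/2` maximality is tested at displaced pairs, and beyond `R/2` only the tail of `u` around `x`
survives. -/
theorem IsDoublingMax.secondDiff_le {u : Rn n → ℝ} {α A B R : ℝ} {p x y : Rn n}
    (hmax : IsDoublingMax u α A B R p x y) (hu : ∀ w, 0 < u w) (hα0 : 0 < α) (hα1 : α < 1)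
    (hA : 0 < A) (hB : 0 ≤ B) (hxp : ‖x - p‖ < R / 2) (hxy : x - y ≠ 0) (hle : u y ≤ u x)
    {ρ : ℝ} (hρ : 0 < ρ) (hρR : ρ ≤ R / 2) {S : Set (Rn n)} {c : ℝ}
    (hS : ∀ z ∈ S, ρ ≤ ‖z‖ ∧ ‖z‖ < R / 2 ∧
      ‖x - y + z‖ ^ α + ‖x - y - z‖ ^ α - 2 * ‖x - y‖ ^ α ≤ -c * ‖x - y‖ ^ α) (z : Rn n) :
    secondDiff (testFun u (upperTest u α A B p x y) x ρ) x z -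
        secondDiff (testFun u (lowerTest u α A x y) y ρ) y z ≤
      (2 * B * truncSq (R / 2) z + 2 * A * α * ‖x - y‖ ^ (α - 2) * truncSq ρ z +
        (tail u x (R / 2) z + tail u x (R / 2) (-z))) -
      S.indicator (fun _ => c * A * ‖x - y‖ ^ α) z := by
  set φ := upperTest u α A B p x y with hφ
  set ψ := lowerTest u α A x y with hψ
  have t1 := mul_nonneg (mul_nonneg zero_le_two hB) (truncSq_nonneg (R / 2) z)
  have t2 : 0 ≤ 2 * A * α * ‖x - y‖ ^ (α - 2) * truncSq ρ z :=
    mul_nonneg (by positivity) (truncSq_nonneg ρ z)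
  have t3 := tail_nonneg hu x (R / 2) z
  have t4 := tail_nonneg hu x (R / 2) (-z)
  have U0 : testFun u φ x ρ x = u x := by
    rw [testFun_of_lt (by simpa), hφ, upperTest]
    ring
  have V0 : testFun u ψ y ρ y = u y := by
    rw [testFun_of_lt (by simpa), hψ, lowerTest]
    ring
  have hpar := norm_sq_add_add_norm_sq_sub (x - p) z
  have e1 : x + z - p = x - p + z := by abel
  have e2 : x - z - p = x - p - z := by abel
  simp only [secondDiff, U0, V0]
  rcases lt_or_ge ‖z‖ ρ with hz | hz
  · have hzS : z ∉ S := fun h => absurd (hS z h).1 (not_le.2 hz)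
    rw [indicator_of_notMem hzS, testFun_of_lt (by simpa), testFun_of_lt (by simpa [dist_eq_norm]),
      testFun_of_lt (by simpa), testFun_of_lt (by simpa [dist_eq_norm]), truncSq_of_lt hz,
      truncSq_of_lt (hz.trans_le hρR)]
    have hb := mul_le_mul_of_nonneg_left (norm_rpow_secondDiff_le hα0 hα1 hxy z)
      (by linarith : 0 ≤ 2 * A)
    have e3 : x + z - y = x - y + z := by abel
    have e4 : x - z - y = x - y - z := by abel
    have e5 : x - (y + z) = x - y - z := by abel
    have e6 : x - (y - z) = x - y + z := by abel
    simp only [hφ, hψ, upperTest, lowerTest, e1, e2, e3, e4, e5, e6]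
    nlinarith
  · rw [testFun_of_le (by simpa), testFun_of_le (by simpa [dist_eq_norm]),
      testFun_of_le (by simpa), testFun_of_le (by simpa [dist_eq_norm])]
    rcases lt_or_ge ‖z‖ (R / 2) with hzR | hzR
    · have b1 : ‖x + z - p‖ ≤ R := by
        rw [e1]
        linarith [norm_add_le (x - p) z]
      have b2 : ‖x - z - p‖ ≤ R := by
        rw [e2]
        linarith [norm_sub_le (x - p) z]
      have m2 := hmax (x - z) (y - z) b2
      rw [truncSq_of_lt hzR]
      rw [e2, sub_sub_sub_cancel_right] at m2
      -- On `S` the pairs `(x+z, y)`, `(x, y+z)` and `(x-z, y-z)` are used: the first two move one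
      -- point only and produce the second difference of the profile. Off `S`, parallel
      -- displacements leave `x-y` unchanged.
      by_cases hzS : z ∈ S
      · rw [indicator_of_mem hzS]
        have m1 := hmax (x + z) y b1
        have m3 := hmax x (y + z) (by linarith [norm_nonneg (x - p)])
        have e3 : x + z - y = x - y + z := by abel
        have e5 : x - (y + z) = x - y - z := by abel
        rw [e1, e3] at m1
        rw [e5] at m3
        have g := mul_le_mul_of_nonneg_left (hS z hzS).2.2 hA.le
        nlinarith
      · rw [indicator_of_notMem hzS]
        have m1 := hmax (x + z) (y + z) b1
        rw [e1, add_sub_add_right_eq_sub] at m1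
        nlinarith
    -- The values at `y±z` enter with a negative sign and are dropped by positivity of `u`; the
    -- central values are dropped by `u y ≤ u x`.
    · have hzS : z ∉ S := fun h => absurd (hS z h).2.1 (not_lt.2 hzR)
      rw [indicator_of_notMem hzS, tail_of_le hzR, tail_of_le (by rwa [norm_neg]),
        ← sub_eq_add_neg]
      linarith [hu (y + z), hu (y - z)]

theorem IsDoublingMax.viscosity_le_add [Nonempty (Fin n)] {I : (Rn n → ℝ) → Rn n → ℝ}
    (hI : IsEllipticSym n s lam Lam I) (hs0 : 0 < s) (hs1 : s < 1) (hlam : 0 < lam)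
    {f : ℝ → ℝ} {u : Rn n → ℝ} (hsol : IsViscositySolution s I f u)
    {α A B R : ℝ} {p x y : Rn n}
    (hmax : IsDoublingMax u α A B R p x y) (hu : ∀ w, 0 < u w) (hα0 : 0 < α) (hα1 : α < 1)
    (hA : 0 < A) (hB : 0 ≤ B) (hR : 0 < R) (hxp : ‖x - p‖ < R / 2) (hxy : x - y ≠ 0)
    (hle : u y ≤ u x) {ρ : ℝ} (hρ : 0 < ρ) (hρR : ρ ≤ R / 2) (hρa : ρ ≤ ‖x - y‖)
    {S : Set (Rn n)} (hSm : MeasurableSet S) {c : ℝ} (hc : 0 ≤ c)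
    (hS : ∀ z ∈ S, ρ ≤ ‖z‖ ∧ ‖z‖ < R / 2 ∧
      ‖x - y + z‖ ^ α + ‖x - y - z‖ ^ α - 2 * ‖x - y‖ ^ α ≤ -c * ‖x - y‖ ^ α) :
    2 * (f (u y) - f (u x)) +
        lam * (c * A * ‖x - y‖ ^ α) * ∫ z in S, ‖z‖ ^ (-((n : ℝ) + 2 * s)) ≤
      Lam * (2 * B * ((R / 2) ^ (2 - 2 * s) *
          ∫ z in Metric.ball (0 : Rn n) 1, ‖z‖ ^ (2 - ((n : ℝ) + 2 * s))) +
        2 * A * α * ‖x - y‖ ^ (α - 2) * (ρ ^ (2 - 2 * s) *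
          ∫ z in Metric.ball (0 : Rn n) 1, ‖z‖ ^ (2 - ((n : ℝ) + 2 * s))) +
        2 * ∫ z in (Metric.ball (0 : Rn n) (R / 2))ᶜ,
          u (x + z) * ‖z‖ ^ (-((n : ℝ) + 2 * s))) := by
  have huw : MemL1Weight s u := hsol.1.memL1
  have hUw : MemL1Weight s (testFun u (upperTest u α A B p x y) x ρ) :=
    memL1Weight_testFun hs0 huw (continuous_upperTest u hα0 A B p x y) x ρ
  have hVw : MemL1Weight s (testFun u (lowerTest u α A x y) y ρ) :=
    memL1Weight_testFun hs0 huw (continuous_lowerTest u hα0 A x y) y ρ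
  have hφ := contDiffOn_upperTest u α A B p x y hρa
  have hψ := contDiffOn_lowerTest u α A x y hρa
  have hsub := hsol.1.test x ρ (upperTest u α A B p x y) hρ hφ hUw
    (by rw [upperTest]; ring) fun w hw => by
      rw [Metric.mem_ball, dist_eq_norm] at hw
      have h1 : ‖w - p‖ ≤ R := by
        have := norm_add_le (w - x) (x - p)
        rw [sub_add_sub_cancel] at this
        linarith
      have := hmax w y h1
      rw [upperTest]
      linarith
  have hsup := hsol.2.test y ρ (lowerTest u α A x y) hρ hψ hVw
    (by rw [lowerTest]; ring) fun w hw => by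
      have := hmax x w (by linarith)
      rw [lowerTest]
      linarith
  obtain ⟨i1, j1⟩ := integral_truncSq (n := n) hs1 (half_pos hR)
  obtain ⟨i2, j2⟩ := integral_truncSq (n := n) hs1 hρ
  obtain ⟨i3, j3⟩ := integral_tail hs0 huw x (half_pos hR)
  have i4 := i3.comp_neg
  have j4 := integral_neg_eq_self
    (fun z : Rn n => tail u x (R / 2) z * ‖z‖ ^ (-((n : ℝ) + 2 * s))) volume
  simp only [norm_neg] at i4 j4
  have i12 : Integrable (fun z : Rn n =>
      2 * B * (truncSq (R / 2) z * ‖z‖ ^ (-((n : ℝ) + 2 * s))) +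
      2 * A * α * ‖x - y‖ ^ (α - 2) * (truncSq ρ z * ‖z‖ ^ (-((n : ℝ) + 2 * s)))) volume :=
    (i1.const_mul _).add (i2.const_mul _)
  have i34 : Integrable (fun z : Rn n =>
      tail u x (R / 2) z * ‖z‖ ^ (-((n : ℝ) + 2 * s)) +
          tail u x (R / 2) (-z) * ‖z‖ ^ (-((n : ℝ) + 2 * s))) volume := i3.add i4
  have i5 := i12.add i34
  have e5 : ∀ z : Rn n, (2 * B * truncSq (R / 2) z +
      2 * A * α * ‖x - y‖ ^ (α - 2) * truncSq ρ z +
        (tail u x (R / 2) z + tail u x (R / 2) (-z))) * ‖z‖ ^ (-((n : ℝ) + 2 * s)) =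
      2 * B * (truncSq (R / 2) z * ‖z‖ ^ (-((n : ℝ) + 2 * s))) +
      2 * A * α * ‖x - y‖ ^ (α - 2) * (truncSq ρ z * ‖z‖ ^ (-((n : ℝ) + 2 * s))) +
        (tail u x (R / 2) z * ‖z‖ ^ (-((n : ℝ) + 2 * s)) +
          tail u x (R / 2) (-z) * ‖z‖ ^ (-((n : ℝ) + 2 * s))) := fun z => by ring
  have hSi : IntegrableOn (fun z : Rn n => ‖z‖ ^ (-((n : ℝ) + 2 * s))) S volume :=
    (integrableOn_compl_ball_norm_rpow (by linarith) hρ).mono_set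
      fun z hz => by simpa using (hS z hz).1
  have key := hI.sub_le hs0 hs1 hlam (c11At_testFun hρ hφ) hUw (c11At_testFun hρ hψ) hVw
    (E := (Lam * (∫ z : Rn n, (2 * B * truncSq (R / 2) z +
      2 * A * α * ‖x - y‖ ^ (α - 2) * truncSq ρ z +
        (tail u x (R / 2) z + tail u x (R / 2) (-z))) * ‖z‖ ^ (-((n : ℝ) + 2 * s))) -
      lam * (c * A * ‖x - y‖ ^ α) * ∫ z in S, ‖z‖ ^ (-((n : ℝ) + 2 * s))) / 2)
    fun K hK hKi => by
      rw [mul_div_cancel₀ _ two_ne_zero]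
      refine integral_mul_kernel_le hlam hK hSm (by positivity) (fun z => ?_)
        (hmax.secondDiff_le hu hα0 hα1 hA hB hxp hxy hle hρ hρR hS) hKi ?_ hSi
      · have t1 := mul_nonneg (mul_nonneg zero_le_two hB) (truncSq_nonneg (R / 2) z)
        have t2 : 0 ≤ 2 * A * α * ‖x - y‖ ^ (α - 2) * truncSq ρ z :=
          mul_nonneg (by positivity) (truncSq_nonneg ρ z)
        have t3 := tail_nonneg hu x (R / 2) z
        have t4 := tail_nonneg hu x (R / 2) (-z)
        linarith
      · exact i5.congr (Eventually.of_forall fun z => (e5 z).symm)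
  simp only [e5] at key
  rw [integral_add i12 i34,
    integral_add (i1.const_mul _) (i2.const_mul _), integral_add i3 i4, integral_const_mul,
    integral_const_mul, j1, j2, j4, j3, ← two_mul] at key
  linarith

/-- Let the gluing radius `ρ` tend to zero: the inner error carries `ρ^(2-2s)` and disappears since
`s < 1`, while `S` stays at distance `δ` from the origin. -/
theorem IsDoublingMax.viscosity_le [Nonempty (Fin n)] {I : (Rn n → ℝ) → Rn n → ℝ}
    (hI : IsEllipticSym n s lam Lam I) (hs0 : 0 < s) (hs1 : s < 1) (hlam : 0 < lam)
    {f : ℝ → ℝ} {u : Rn n → ℝ} (hsol : IsViscositySolution s I f u)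
    {α A B R : ℝ} {p x y : Rn n}
    (hmax : IsDoublingMax u α A B R p x y) (hu : ∀ w, 0 < u w) (hα0 : 0 < α) (hα1 : α < 1)
    (hA : 0 < A) (hB : 0 ≤ B) (hR : 0 < R) (hxp : ‖x - p‖ < R / 2) (hxy : x - y ≠ 0)
    (hle : u y ≤ u x) {δ : ℝ} (hδ : 0 < δ)
    {S : Set (Rn n)} (hSm : MeasurableSet S) {c : ℝ} (hc : 0 ≤ c)
    (hS : ∀ z ∈ S, δ ≤ ‖z‖ ∧ ‖z‖ < R / 2 ∧
      ‖x - y + z‖ ^ α + ‖x - y - z‖ ^ α - 2 * ‖x - y‖ ^ α ≤ -c * ‖x - y‖ ^ α) :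
    2 * (f (u y) - f (u x)) +
        lam * (c * A * ‖x - y‖ ^ α) * ∫ z in S, ‖z‖ ^ (-((n : ℝ) + 2 * s)) ≤
      Lam * (2 * B * ((R / 2) ^ (2 - 2 * s) *
          ∫ z in Metric.ball (0 : Rn n) 1, ‖z‖ ^ (2 - ((n : ℝ) + 2 * s))) +
        2 * ∫ z in (Metric.ball (0 : Rn n) (R / 2))ᶜ,
          u (x + z) * ‖z‖ ^ (-((n : ℝ) + 2 * s))) := by
  set κ := ∫ z in Metric.ball (0 : Rn n) 1, ‖z‖ ^ (2 - ((n : ℝ) + 2 * s))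
  set T := ∫ z in (Metric.ball (0 : Rn n) (R / 2))ᶜ, u (x + z) * ‖z‖ ^ (-((n : ℝ) + 2 * s))
  have hlim : Tendsto (fun ρ : ℝ => Lam * (2 * B * ((R / 2) ^ (2 - 2 * s) * κ) +
      2 * A * α * ‖x - y‖ ^ (α - 2) * (ρ ^ (2 - 2 * s) * κ) + 2 * T)) (𝓝[>] 0)
      (𝓝 (Lam * (2 * B * ((R / 2) ^ (2 - 2 * s) * κ) +
      2 * A * α * ‖x - y‖ ^ (α - 2) * (0 ^ (2 - 2 * s) * κ) + 2 * T))) := by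
    refine Tendsto.mono_left ?_ nhdsWithin_le_nhds
    have h1 : Tendsto (fun ρ : ℝ => ρ ^ (2 - 2 * s)) (𝓝 0) (𝓝 (0 ^ (2 - 2 * s))) :=
      (Real.continuousAt_rpow_const 0 (2 - 2 * s) (Or.inr (by linarith))).tendsto
    exact ((((h1.mul_const κ).const_mul _).const_add _).add_const _).const_mul _
  rw [Real.zero_rpow (by linarith), zero_mul, mul_zero, add_zero] at hlim
  refine ge_of_tendsto hlim ?_
  have h0 : 0 < min δ (min (R / 2) ‖x - y‖) :=
    lt_min hδ (lt_min (half_pos hR) (norm_pos_iff.2 hxy))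
  filter_upwards [Ioo_mem_nhdsGT h0] with ρ hρ
  obtain ⟨hρ0, hρ1⟩ := hρ
  rw [lt_min_iff, lt_min_iff] at hρ1
  exact hmax.viscosity_le_add hI hs0 hs1 hlam hsol hu hα0 hα1 hA hB hR hxp hxy hle hρ0
    hρ1.2.1.le hρ1.2.2.le hSm hc fun z hz => ⟨hρ1.1.le.trans (hS z hz).1, (hS z hz).2⟩

/-! ### Size of the gain, size of the tail, existence of a maximum. -/

theorem setIntegral_gain_ge [Nonempty (Fin n)] (hs0 : 0 < s) {η : ℝ} (hη0 : 0 < η)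
    (hη1 : η < 1 / 4) {a : Rn n} (ha : a ≠ 0) :
    η ^ n * volume.real (Metric.ball (0 : Rn n) 1) * ‖a‖ ^ (-(2 * s)) ≤
      ∫ z in Metric.ball ((1 / 2 : ℝ) • a) (η * ‖a‖), ‖z‖ ^ (-((n : ℝ) + 2 * s)) := by
  have ha0 : 0 < ‖a‖ := norm_pos_iff.2 ha
  have hb : MeasurableSet (Metric.ball ((1 / 2 : ℝ) • a) (η * ‖a‖)) :=
    Metric.isOpen_ball.measurableSet
  have hnorm : ∀ z ∈ Metric.ball ((1 / 2 : ℝ) • a) (η * ‖a‖), ‖a‖ / 4 ≤ ‖z‖ ∧ ‖z‖ ≤ ‖a‖ := by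
    intro z hz
    rw [Metric.mem_ball, dist_eq_norm] at hz
    have h1 : ‖(1 / 2 : ℝ) • a‖ = ‖a‖ / 2 := by
      rw [norm_smul, Real.norm_of_nonneg (by norm_num)]
      ring
    have h2 := norm_sub_norm_le z ((1 / 2 : ℝ) • a)
    have h3 := norm_sub_norm_le ((1 / 2 : ℝ) • a) z
    rw [norm_sub_rev] at h3
    constructor <;> nlinarith
  have hvol : volume.real (Metric.ball ((1 / 2 : ℝ) • a) (η * ‖a‖)) =
      (η * ‖a‖) ^ n * volume.real (Metric.ball (0 : Rn n) 1) := by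
    rw [measureReal_def, Measure.addHaar_ball _ _ (by positivity), ENNReal.toReal_mul,
      ENNReal.toReal_ofReal (by positivity), finrank_euclideanSpace, Fintype.card_fin,
      measureReal_def]
  have hle := setIntegral_mono_on (μ := volume) (f := fun _ : Rn n => ‖a‖ ^ (-((n : ℝ) + 2 * s)))
    (integrableOn_const (Metric.isBounded_ball.measure_lt_top).ne)
    ((integrableOn_compl_ball_norm_rpow (n := n) (τ := -((n : ℝ) + 2 * s)) (by linarith)
      (by linarith : 0 < ‖a‖ / 4)).mono_set fun z hz => by simpa using (hnorm z hz).1) hb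
    fun z hz => Real.rpow_le_rpow_of_nonpos (lt_of_lt_of_le (by linarith) (hnorm z hz).1)
      (hnorm z hz).2 (by linarith [(Nat.cast_nonneg n : (0 : ℝ) ≤ n)])
  rw [setIntegral_const, smul_eq_mul, hvol] at hle
  refine le_trans (le_of_eq ?_) hle
  rw [neg_add, Real.rpow_add ha0, Real.rpow_neg ha0.le (n : ℝ),
    Real.rpow_natCast, mul_pow]
  field_simp

/-- For `γ < 2s` the growth bound is integrated directly. For `γ ≥ 2s` that integral may diverge,
but membership in `L¹(ω_s)` bounds the tail by a constant, which suffices since `R^(γ-2s) ≥ 1`. -/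
theorem exists_tail_bound [Nonempty (Fin n)] (hs0 : 0 < s) {u : Rn n → ℝ}
    (hu : ∀ w, 0 < u w) (huw : MemL1Weight s u) {C γ : ℝ} (hC : 0 < C) (hγ : 0 < γ)
    (hg : ∀ w, u w ≤ C * (1 + ‖w‖) ^ γ) (p : Rn n) :
    ∃ C₁ : ℝ, 0 ≤ C₁ ∧ ∀ R : ℝ, 2 * (1 + ‖p‖) ≤ R → ∀ x : Rn n, ‖x - p‖ ≤ R / 2 →
      ∫ z in (Metric.ball (0 : Rn n) (R / 2))ᶜ, u (x + z) * ‖z‖ ^ (-((n : ℝ) + 2 * s)) ≤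
        C₁ * R ^ (γ - 2 * s) := by
  have hp0 := norm_nonneg p
  rcases lt_or_ge γ (2 * s) with h2 | h2
  · refine ⟨C * 3 ^ γ * ((1 / 2) ^ (γ - 2 * s) *
      ∫ z in (Metric.ball (0 : Rn n) 1)ᶜ, ‖z‖ ^ (γ - ((n : ℝ) + 2 * s))), ?_, ?_⟩
    · exact mul_nonneg (by positivity) (mul_nonneg (by positivity)
        (integral_nonneg fun z => Real.rpow_nonneg (norm_nonneg z) _))
    intro R hR x hx
    have hR0 : 0 < R / 2 := by linarith
    have hi := integrableOn_compl_ball_norm_rpow (n := n) (τ := γ - ((n : ℝ) + 2 * s))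
      (by linarith) hR0
    have h3 := setIntegral_mono_on (huw.integrableOn_compl_ball hs0 x hR0)
      (hi.const_mul (C * 3 ^ γ)) Metric.isOpen_ball.measurableSet.compl fun z hz => by
        have hz : R / 2 ≤ ‖z‖ := by simpa using hz
        have hz0 : 0 < ‖z‖ := hR0.trans_le hz
        have h4 : 1 + ‖x + z‖ ≤ 3 * ‖z‖ := by
          have h5 := norm_add_le x z
          have h6 := norm_add_le (x - p) p
          rw [sub_add_cancel] at h6
          linarith
        have h7 : u (x + z) ≤ C * 3 ^ γ * ‖z‖ ^ γ := by
          refine (hg _).trans ?_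
          rw [mul_assoc, ← Real.mul_rpow (by norm_num) hz0.le]
          exact mul_le_mul_of_nonneg_left (Real.rpow_le_rpow (by positivity) h4 hγ.le) hC.le
        rw [sub_eq_add_neg γ, Real.rpow_add hz0, ← mul_assoc]
        exact mul_le_mul_of_nonneg_right h7 (by positivity)
    refine h3.trans (le_of_eq ?_)
    rw [integral_const_mul, setIntegral_compl_ball_norm_rpow _ hR0,
      (by ring : (n : ℝ) + (γ - ((n : ℝ) + 2 * s)) = γ - 2 * s), div_eq_mul_one_div R,
      Real.mul_rpow (by linarith) (by norm_num)]
    ring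
  · have hpos : ∀ z : Rn n, 0 ≤ u z * weight n s z := fun z =>
      mul_nonneg (hu z).le (weight_pos z).le
    refine ⟨3 ^ ((n : ℝ) + 2 * s) * ∫ z, u z * weight n s z, ?_, ?_⟩
    · exact mul_nonneg (by positivity) (integral_nonneg hpos)
    intro R hR x hx
    have hR0 : 0 < R / 2 := by linarith
    have hi := (integrable_shift_mul_weight huw x).const_mul (3 ^ ((n : ℝ) + 2 * s))
    have h3 := setIntegral_mono_on (huw.integrableOn_compl_ball hs0 x hR0)
      hi.integrableOn Metric.isOpen_ball.measurableSet.compl fun z hz => by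
        have hz : R / 2 ≤ ‖z‖ := by simpa using hz
        have h4 := rpow_neg_le_weight hs0 hR0 x z hz
        have h5 : 1 + (1 + ‖x‖) / (R / 2) ≤ 3 := by
          have h6 := norm_add_le (x - p) p
          rw [sub_add_cancel] at h6
          have : (1 + ‖x‖) / (R / 2) ≤ 2 := by
            rw [div_le_iff₀ hR0]
            linarith
          linarith
        have h6 : (1 + (1 + ‖x‖) / (R / 2)) ^ ((n : ℝ) + 2 * s) ≤ 3 ^ ((n : ℝ) + 2 * s) :=
          Real.rpow_le_rpow (by positivity) h5 (by positivity)
        rw [mul_left_comm]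
        exact mul_le_mul_of_nonneg_left (h4.trans
          (mul_le_mul_of_nonneg_right h6 (weight_pos _).le)) (hu _).le
    refine h3.trans ?_
    have h7 := setIntegral_le_integral (s := (Metric.ball (0 : Rn n) (R / 2))ᶜ) hi
      (Eventually.of_forall fun z => mul_nonneg (by positivity) (hpos (x + z)))
    refine h7.trans ?_
    rw [integral_const_mul, integral_add_left_eq_self (fun z => u z * weight n s z) x]
    refine le_mul_of_one_le_right ?_ (Real.one_le_rpow (by linarith) (by linarith))
    exact mul_nonneg (by positivity) (integral_nonneg hpos)

/-- Although `y` ranges over the whole space, positivity of `u` makes the doubled function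
nonpositive once `A|x-y|^α` exceeds the maximum of `u` on the ball. Its value at `(p, q)` is
positive, so a compact set of `y` is enough. -/
theorem exists_isDoublingMax {u : Rn n → ℝ} (hc : Continuous u) (hu : ∀ w, 0 < u w)
    {α A B R : ℝ} (hα : 0 < α) (hA : 0 < A) (hB : 0 ≤ B) (hR : 0 ≤ R) {p q : Rn n}
    (hpq : 0 < u p - u q - A * ‖p - q‖ ^ α) :
    ∃ x y : Rn n, ‖x - p‖ ≤ R ∧ IsDoublingMax u α A B R p x y ∧
      0 < u x - u y - A * ‖x - y‖ ^ α - B * ‖x - p‖ ^ 2 := by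
  obtain ⟨M, hM⟩ := (isCompact_closedBall p R).exists_bound_of_continuousOn hc.continuousOn
  have hM0 : 0 ≤ M := (norm_nonneg _).trans (hM p (Metric.mem_closedBall_self hR))
  set R' : ℝ := (M / A) ^ (1 / α)
  have hR' : 0 ≤ R' := by positivity
  set Y := Metric.closedBall p (R + R' + ‖q - p‖)
  have hcpt : IsCompact (Metric.closedBall p R ×ˢ Y) :=
    (isCompact_closedBall p R).prod (isCompact_closedBall p _)
  have hmem : (p, q) ∈ Metric.closedBall p R ×ˢ Y := by
    refine ⟨Metric.mem_closedBall_self hR, ?_⟩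
    rw [Metric.mem_closedBall, dist_eq_norm]
    linarith
  have hcont : Continuous fun w : Rn n × Rn n =>
      u w.1 - u w.2 - A * ‖w.1 - w.2‖ ^ α - B * ‖w.1 - p‖ ^ 2 := by
    have : Continuous fun w : Rn n × Rn n => ‖w.1 - w.2‖ ^ α :=
      Continuous.rpow_const (by fun_prop) fun _ => Or.inr hα.le
    fun_prop
  obtain ⟨⟨x, y⟩, ⟨hx, -⟩, hm⟩ := hcpt.exists_isMaxOn ⟨_, hmem⟩ hcont.continuousOn
  have hpos : 0 < u x - u y - A * ‖x - y‖ ^ α - B * ‖x - p‖ ^ 2 := by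
    have := hm hmem
    simp only [mem_ofPred_eq, sub_self, norm_zero] at this
    linarith
  refine ⟨x, y, by simpa [dist_eq_norm] using hx, fun x' y' hx' => ?_, hpos⟩
  have hx'' : x' ∈ Metric.closedBall p R := by simpa [dist_eq_norm] using hx'
  by_cases hy' : y' ∈ Y
  · exact hm (show (x', y') ∈ _ from ⟨hx'', hy'⟩)
  · refine le_trans ?_ hpos.le
    have h1 : R' ≤ ‖x' - y'‖ := by
      rw [Metric.mem_closedBall, dist_eq_norm, not_le] at hy'
      have := norm_sub_le (x' - p) (x' - y')
      rw [sub_sub_sub_cancel_left] at this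
      linarith [norm_nonneg (q - p)]
    have h2 := Real.rpow_le_rpow hR' h1 hα.le
    rw [← Real.rpow_mul (by positivity), one_div_mul_cancel hα.ne', Real.rpow_one,
      div_le_iff₀ hA] at h2
    have h3 := (Real.le_norm_self _).trans (hM x' hx'')
    have h4 : 0 ≤ B * ‖x' - p‖ ^ 2 := by positivity
    linarith [hu y']

/-! ### The scale-`R` estimate for the distance between the doubling points. -/

theorem exists_doubling_estimate [Nonempty (Fin n)] {I : (Rn n → ℝ) → Rn n → ℝ}
    (hI : IsEllipticSym n s lam Lam I) (hs0 : 0 < s) (hs1 : s < 1) (hlam : 0 < lam)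
    (hLam : lam ≤ Lam) {f : ℝ → ℝ} (hfm : AntitoneOn f (Ioi 0)) {u : Rn n → ℝ}
    (hsol : IsViscositySolution s I f u) (hu : ∀ w, 0 < u w) {C γ : ℝ} (hC : 0 < C)
    (hγ : 0 < γ) (hg : ∀ w, u w ≤ C * (1 + ‖w‖) ^ γ) {α : ℝ} (hα0 : 0 < α) (hα1 : α < 1)
    {p q : Rn n} (hpq : u q < u p) :
    ∃ D R₀ : ℝ, 0 < D ∧ 1 ≤ R₀ ∧ ∀ R, R₀ ≤ R → ∀ G : ℝ, 0 ≤ G →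
      (∀ a b : ℝ, 0 < a → a < b → b ≤ D * R ^ γ → G * (b - a) ≤ f a - f b) →
      ∃ t : ℝ, 0 < t ∧ t ^ α ≤ D * R ^ γ ∧ G * t ^ α ≤ D * R ^ (γ - 2 * s) ∧
        (t ≤ R / 2 → t ^ (α - 2 * s) ≤ D * R ^ (γ - 2 * s)) := by
  have hLam0 : 0 < Lam := hlam.trans_le hLam
  have huc : Continuous u := continuous_iff_lower_upperSemicontinuous.2 ⟨hsol.2.lsc, hsol.1.usc⟩
  have hpq0 : 0 < ‖p - q‖ := norm_pos_iff.2 (sub_ne_zero.2 fun h => by simp [h] at hpq)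
  -- Half the Hölder quotient of `u` between `p` and `q`; it is independent of `R`.
  obtain ⟨A, hA, hApq⟩ : ∃ A : ℝ, 0 < A ∧ 0 < u p - u q - A * ‖p - q‖ ^ α := by
    refine ⟨(u p - u q) / 2 / ‖p - q‖ ^ α, by have := sub_pos.2 hpq; positivity, ?_⟩
    rw [div_mul_cancel₀ _ (by positivity)]
    linarith
  obtain ⟨C₁, hC₁, htail⟩ := exists_tail_bound hs0 hu hsol.1.memL1 hC hγ hg p
  obtain ⟨η, c, hη0, hη1, hc, hgain⟩ := exists_profile_gain hα0 hα1
  obtain ⟨κ, hκ⟩ : ∃ κ, κ = ∫ z in Metric.ball (0 : Rn n) 1, ‖z‖ ^ (2 - ((n : ℝ) + 2 * s)) :=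
    ⟨_, rfl⟩
  have hκ0 : 0 ≤ κ := hκ ▸ integral_nonneg fun z => Real.rpow_nonneg (norm_nonneg z) _
  obtain ⟨v, hv⟩ : ∃ v, v = η ^ n * volume.real (Metric.ball (0 : Rn n) 1) := ⟨_, rfl⟩
  have hv0 : 0 < v := by
    have : 0 < volume.real (Metric.ball (0 : Rn n) 1) :=
      ENNReal.toReal_pos (Metric.measure_ball_pos volume _ one_pos).ne'
        (Metric.isBounded_ball.measure_lt_top).ne
    exact hv ▸ mul_pos (pow_pos hη0 n) this
  obtain ⟨C₃, hC₃⟩ : ∃ C₃, C₃ = C * 2 ^ γ := ⟨_, rfl⟩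
  have hC₃0 : 0 < C₃ := by rw [hC₃]; positivity
  obtain ⟨C₄, hC₄⟩ : ∃ C₄, C₄ = Lam * (2 * (4 * C₃) * ((1 / 2) ^ (2 - 2 * s) * κ) + 2 * C₁) := ⟨_, rfl⟩
  have hC₄0 : 0 ≤ C₄ := by rw [hC₄]; positivity
  -- The summands serve, in order, the bound on `u x`, the bound on `t^α`, the estimate with `G`,
  -- and the estimate from the concavity gain.
  obtain ⟨D, hD⟩ : ∃ D, D = C₃ + C₃ / A + C₄ / (2 * A) + C₄ / (lam * (c * A) * v) := ⟨_, rfl⟩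
  have d1 : 0 ≤ C₃ / A := by positivity
  have d2 : 0 ≤ C₄ / (2 * A) := by positivity
  have d3 : 0 ≤ C₄ / (lam * (c * A) * v) := by positivity
  refine ⟨D, 2 * (1 + ‖p‖), by linarith, by linarith [norm_nonneg p], fun R hR G hG hGf => ?_⟩
  have hp0 := norm_nonneg p
  have hR0 : 0 < R := by linarith
  have hRγ : 0 < R ^ γ := by positivity
  have hRs : 0 < R ^ (γ - 2 * s) := by positivity
  have hugrowth : ∀ x : Rn n, ‖x - p‖ ≤ R → u x ≤ C₃ * R ^ γ := fun x hx => by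
    refine (hg x).trans ?_
    rw [hC₃, mul_assoc, ← Real.mul_rpow (by norm_num) hR0.le]
    refine mul_le_mul_of_nonneg_left (Real.rpow_le_rpow (by positivity) ?_ hγ.le) hC.le
    have h6 := norm_add_le (x - p) p
    rw [sub_add_cancel] at h6
    linarith
  -- With this `B`, the penalty at `|x-p| ≥ R/2` is at least `C₃ R^γ`, hence at least `u x`, which
  -- would contradict positivity of the maximum.
  obtain ⟨x, y, hxR, hmax, hpos⟩ := exists_isDoublingMax (B := 4 * C₃ * R ^ (γ - 2)) huc hu hα0
    hA (by positivity) hR0.le hApq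
  have hRsq : R ^ (γ - 2) * R ^ 2 = R ^ γ := by
    rw [Real.rpow_sub hR0, Real.rpow_ofNat]
    field_simp
  have hAt0 : 0 ≤ A * ‖x - y‖ ^ α := by positivity
  have hB0 : 0 ≤ 4 * C₃ * R ^ (γ - 2) * ‖x - p‖ ^ 2 := by positivity
  have huxR := hugrowth x hxR
  have hxp : ‖x - p‖ < R / 2 := by
    by_contra! h
    have h1 : (R / 2) ^ 2 ≤ ‖x - p‖ ^ 2 := pow_le_pow_left₀ (by linarith) h 2
    have h2 : C₃ * R ^ γ ≤ 4 * C₃ * R ^ (γ - 2) * ‖x - p‖ ^ 2 := by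
      calc C₃ * R ^ γ = 4 * C₃ * R ^ (γ - 2) * (R / 2) ^ 2 := by rw [← hRsq]; ring
        _ ≤ _ := mul_le_mul_of_nonneg_left h1 (by positivity)
    linarith [hu y]
  have hle : u y < u x := by linarith
  have hxy : x - y ≠ 0 := sub_ne_zero.2 fun h => by simp [h] at hle
  have ht0 : 0 < ‖x - y‖ := norm_pos_iff.2 hxy
  have hE : Lam * (2 * (4 * C₃ * R ^ (γ - 2)) * ((R / 2) ^ (2 - 2 * s) * κ) +
      2 * ∫ z in (Metric.ball (0 : Rn n) (R / 2))ᶜ,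
        u (x + z) * ‖z‖ ^ (-((n : ℝ) + 2 * s))) ≤ C₄ * R ^ (γ - 2 * s) := by
    have h1 := htail R hR x hxp.le
    have h2 : R ^ (γ - 2) * (R / 2) ^ (2 - 2 * s) = R ^ (γ - 2 * s) * (1 / 2) ^ (2 - 2 * s) := by
      rw [div_eq_mul_one_div R, Real.mul_rpow hR0.le (by norm_num), ← mul_assoc,
        ← Real.rpow_add hR0]
      congr 2
      ring
    rw [hC₄, mul_assoc Lam]
    refine mul_le_mul_of_nonneg_left ?_ hLam0.le
    have h3 : 2 * (4 * C₃ * R ^ (γ - 2)) * ((R / 2) ^ (2 - 2 * s) * κ) =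
        2 * (4 * C₃) * (R ^ (γ - 2 * s) * (1 / 2) ^ (2 - 2 * s)) * κ := by
      rw [← h2]
      ring
    rw [h3]
    linarith
  refine ⟨‖x - y‖, ht0, ?_, ?_, fun htR => ?_⟩
  · have h1 : ‖x - y‖ ^ α ≤ C₃ / A * R ^ γ := by
      rw [div_mul_eq_mul_div, le_div_iff₀ hA]
      linarith [hu y]
    exact h1.trans (mul_le_mul_of_nonneg_right (by linarith) hRγ.le)
  -- With `S = ∅` the concavity gain is discarded, so this bound holds even when `t` exceeds `R/2`.
  · have h1 := hmax.viscosity_le hI hs0 hs1 hlam hsol hu hα0 hα1 hA (by positivity) hR0 hxp hxy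
      hle.le one_pos MeasurableSet.empty le_rfl (by simp)
    rw [← hκ, setIntegral_empty, mul_zero, add_zero] at h1
    have h2 := hGf (u y) (u x) (hu y) hle
      (huxR.trans (mul_le_mul_of_nonneg_right (by linarith) hRγ.le))
    have h3 : G * (A * ‖x - y‖ ^ α) ≤ G * (u x - u y) :=
      mul_le_mul_of_nonneg_left (by linarith) hG
    have h4 : G * ‖x - y‖ ^ α ≤ C₄ / (2 * A) * R ^ (γ - 2 * s) := by
      rw [div_mul_eq_mul_div, le_div_iff₀ (by positivity)]
      linarith [h1.trans hE]
    exact h4.trans (mul_le_mul_of_nonneg_right (by linarith) hRs.le)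
  -- Here the difference of `f` is discarded by monotonicity. The condition `t ≤ R/2` places the
  -- gain ball inside the ball of radius `R/2`.
  · have h1 := hmax.viscosity_le hI hs0 hs1 hlam hsol hu hα0 hα1 hA (by positivity) hR0 hxp hxy
      hle.le (δ := ‖x - y‖ / 4) (by linarith)
      (S := Metric.ball ((1 / 2 : ℝ) • (x - y)) (η * ‖x - y‖))
      Metric.isOpen_ball.measurableSet hc.le fun z hz => by
        rw [Metric.mem_ball, dist_eq_norm] at hz
        have e1 : ‖(1 / 2 : ℝ) • (x - y)‖ = ‖x - y‖ / 2 := by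
          rw [norm_smul, Real.norm_of_nonneg (by norm_num)]
          ring
        have e2 := norm_sub_norm_le z ((1 / 2 : ℝ) • (x - y))
        have e3 := norm_sub_norm_le ((1 / 2 : ℝ) • (x - y)) z
        rw [norm_sub_rev] at e3
        have e4 : η * ‖x - y‖ ≤ 1 / 4 * ‖x - y‖ := mul_le_mul_of_nonneg_right hη1.le ht0.le
        exact ⟨by linarith, by linarith, hgain n (x - y) z hz⟩
    rw [← hκ] at h1
    have h2 := setIntegral_gain_ge hs0 hη0 hη1 hxy
    rw [← hv] at h2
    have h3 : f (u x) ≤ f (u y) := hfm (hu y) (hu x) hle.le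
    have h4 := mul_le_mul_of_nonneg_left h2
      (by positivity : 0 ≤ lam * (c * A * ‖x - y‖ ^ α))
    have h5 : ‖x - y‖ ^ (α - 2 * s) = ‖x - y‖ ^ α * ‖x - y‖ ^ (-(2 * s)) := by
      rw [sub_eq_add_neg α, Real.rpow_add ht0]
    have h6 : ‖x - y‖ ^ (α - 2 * s) ≤ C₄ / (lam * (c * A) * v) * R ^ (γ - 2 * s) := by
      rw [div_mul_eq_mul_div, le_div_iff₀ (by positivity), h5]
      linarith [h1.trans hE]
    exact h6.trans (mul_le_mul_of_nonneg_right (by linarith) hRs.le)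

/-! ### Contradictions as `R → ∞`. -/

/-- Since `γ < α`, the first bound gives `t ≤ R/2` for large `R`. Raising it to the power
`-(2s-α)/α` bounds `t^(α-2s)` below by a multiple of `R^(-γ(2s-α)/α)`, which beats `R^(γ-2s)`
because the exponents differ by `2s(α-γ)/α > 0`. -/
theorem false_of_estimate_of_lt {s γ α D R₀ : ℝ} (hs0 : 0 < s) (hγ : 0 < γ) (hγα : γ < α)
    (hαs : α < 2 * s) (hD : 0 < D) (hR₀ : 1 ≤ R₀)
    (h : ∀ R, R₀ ≤ R → ∃ t : ℝ, 0 < t ∧ t ^ α ≤ D * R ^ γ ∧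
      (t ≤ R / 2 → t ^ (α - 2 * s) ≤ D * R ^ (γ - 2 * s))) : False := by
  have hα : 0 < α := hγ.trans hγα
  set e := (2 * s - α) / α with he
  have he0 : 0 < e := div_pos (by linarith) hα
  have hx : 0 < 2 * s - γ - γ * e := by
    have : 2 * s - γ - γ * e = 2 * s * ((α - γ) / α) := by
      rw [he]
      field_simp
      ring
    rw [this]
    have := sub_pos.2 hγα
    positivity
  obtain ⟨R, hR, h1, h2⟩ := ((eventually_ge_atTop R₀).and
    (((tendsto_rpow_atTop (sub_pos.2 hγα)).eventually_gt_atTop (D * 2 ^ α)).and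
    ((tendsto_rpow_atTop hx).eventually_gt_atTop (D * D ^ e)))).exists
  have hR0 : 0 < R := by linarith
  obtain ⟨t, ht, h3, h4⟩ := h R hR
  have htR : t ≤ R / 2 := by
    by_contra! hlt
    have h5 := (Real.rpow_le_rpow (by linarith) hlt.le hα.le).trans h3
    rw [Real.div_rpow hR0.le (by norm_num), div_le_iff₀ (by positivity)] at h5
    rw [Real.rpow_sub hR0, lt_div_iff₀ (by positivity)] at h1
    linarith
  have h5 := h4 htR
  have h6 : (D * R ^ γ) ^ (-e) ≤ t ^ (α - 2 * s) := by
    have h7 : t ^ (α - 2 * s) = (t ^ α) ^ (-e) := by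
      rw [← Real.rpow_mul ht.le]
      congr 1
      rw [he]
      field_simp
      ring
    rw [h7]
    exact Real.rpow_le_rpow_of_nonpos (by positivity) h3 (by linarith)
  have h8 := h6.trans h5
  rw [Real.mul_rpow hD.le (by positivity), ← Real.rpow_mul hR0.le, Real.rpow_neg hD.le,
    inv_mul_le_iff₀ (by positivity)] at h8
  have h9 : R ^ (2 * s - γ - γ * e) = R ^ (γ * -e) * (R ^ (γ - 2 * s))⁻¹ := by
    rw [← Real.rpow_neg hR0.le, ← Real.rpow_add hR0]
    congr 1
    ring
  rw [h9, ← div_eq_mul_inv, lt_div_iff₀ (by positivity)] at h2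
  linarith

/-- The two bounds balance at `t = F^(-1/(2s))`: on either side of it they give `F^((2s-α)/(2s)) ≤ D
R^(γ-2s)`. With `θ = (1-β)/2` and `α = 1 - θ(2s-1)`, the left side is `X^(1+θ)`, where `X` is the
power of `F` in the limsup hypothesis. -/
theorem false_of_estimate_of_derivative {s γ β D R₀ : ℝ} (hs : 1 / 2 < s) (hs1 : s < 1)
    (hγ : 1 ≤ γ) (hβ0 : 0 < β) (hβ1 : β < 1) (hD : 0 < D) (hR₀ : 1 ≤ R₀) {F : ℝ → ℝ}
    (hF : ∀ R, 0 ≤ F R)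
    (hfreq : ∀ N : ℝ, ∃ᶠ R in atTop,
      N < R ^ (2 * s - (2 - β) * γ) * F R ^ ((2 * s - 1) / (2 * s)))
    (h : ∀ R, R₀ ≤ R → ∀ Q, 0 < Q → D * R ^ γ ≤ Q ^ γ → ∃ t : ℝ, 0 < t ∧
      F Q * t ^ (1 - (1 - β) / 2 * (2 * s - 1)) ≤ D * R ^ (γ - 2 * s) ∧
      (t ≤ R / 2 → t ^ (1 - (1 - β) / 2 * (2 * s - 1) - 2 * s) ≤ D * R ^ (γ - 2 * s))) :
    False := by
  set θ := (1 - β) / 2 with hθ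
  set α := 1 - θ * (2 * s - 1) with hα
  have hθ0 : 0 < θ := by linarith
  have hs2 : 0 < 2 * s - 1 := by linarith
  have hαs : α < 2 * s := by nlinarith
  have hα0 : 0 ≤ α := by nlinarith
  set k := max 1 D with hk
  have hk1 : 1 ≤ k := le_max_left _ _
  have hk0 : 0 < k := by linarith
  have hkD : D ≤ k ^ γ := by
    refine (le_max_right 1 D).trans ?_
    calc k = k ^ (1 : ℝ) := (Real.rpow_one k).symm
      _ ≤ k ^ γ := Real.rpow_le_rpow_of_exponent_le hk1 hγ
  -- The `1` gives `N ≤ N^(1+θ)`, the second term defeats the final upper bound, and the third makes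
  -- the balancing radius at most `R/2`.
  set N := 1 + D * k ^ (2 * s - γ) + (2 * k) ^ (2 * s - 1) with hN
  have hN1 : 0 < D * k ^ (2 * s - γ) := by positivity
  have hN2 : 0 < (2 * k) ^ (2 * s - 1) := by positivity
  obtain ⟨Q, hQ, hQR⟩ := ((hfreq N).and_eventually (eventually_ge_atTop (k * R₀))).exists
  have hQ1 : 1 ≤ Q := by nlinarith
  have hQ0 : 0 < Q := by linarith
  have hRQ : R₀ ≤ Q / k := by
    rw [le_div_iff₀ hk0]
    linarith
  have hDQ : D * (Q / k) ^ γ ≤ Q ^ γ := by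
    rw [Real.div_rpow hQ0.le hk0.le, mul_div_assoc', div_le_iff₀ (by positivity), mul_comm]
    exact mul_le_mul_of_nonneg_left hkD (by positivity)
  -- The estimate is applied at the smaller scale `R = Q/k`, so that `Q^γ` dominates `D R^γ`.
  obtain ⟨t, ht, h1, h2⟩ := h (Q / k) hRQ Q hQ0 hDQ
  have hF0 : 0 < F Q := by
    refine lt_of_le_of_ne (hF Q) fun h0 => ?_
    rw [← h0, Real.zero_rpow (by positivity), mul_zero] at hQ
    linarith
  set X := F Q ^ ((2 * s - 1) / (2 * s)) with hX
  have hX0 : 0 < X := by positivity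
  have hXN : N * Q ^ ((2 - β) * γ - 2 * s) ≤ X := by
    have : Q ^ (2 * s - (2 - β) * γ) = (Q ^ ((2 - β) * γ - 2 * s))⁻¹ := by
      rw [← Real.rpow_neg hQ0.le]
      congr 1
      ring
    rw [this, inv_mul_eq_div, lt_div_iff₀ (by positivity)] at hQ
    exact hQ.le
  have hradius : F Q ^ (-(1 / (2 * s))) ≤ Q / k / 2 := by
    have e1 : F Q ^ (-(1 / (2 * s))) = (X ^ (1 / (2 * s - 1)))⁻¹ := by
      rw [hX, ← Real.rpow_mul hF0.le, ← Real.rpow_neg hF0.le]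
      congr 1
      field_simp
    have e2 : (2 * k / Q) ^ (2 * s - 1) ≤ X := by
      refine le_trans ?_ hXN
      rw [Real.div_rpow (by positivity) hQ0.le, div_eq_mul_inv, ← Real.rpow_neg hQ0.le]
      refine mul_le_mul (by linarith) (Real.rpow_le_rpow_of_exponent_le hQ1 (by nlinarith))
        (by positivity) (by linarith)
    have e3 := Real.rpow_le_rpow (by positivity) e2 (by positivity : 0 ≤ 1 / (2 * s - 1))
    rw [← Real.rpow_mul (by positivity), mul_one_div_cancel hs2.ne', Real.rpow_one] at e3
    rw [e1, (by field_simp : Q / k / 2 = (2 * k / Q)⁻¹)]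
    exact inv_anti₀ (by positivity) e3
  have hupper : F Q ^ ((2 * s - α) / (2 * s)) ≤ D * (Q / k) ^ (γ - 2 * s) := by
    rcases le_or_gt (F Q ^ (-(1 / (2 * s)))) t with hle | hlt
    · refine le_trans ?_ h1
      have e1 : F Q ^ ((2 * s - α) / (2 * s)) = F Q * (F Q ^ (-(1 / (2 * s)))) ^ α := by
        rw [← Real.rpow_mul hF0.le]
        nth_rewrite 2 [← Real.rpow_one (F Q)]
        rw [← Real.rpow_add hF0]
        congr 1
        field_simp
        ring
      rw [e1]
      exact mul_le_mul_of_nonneg_left (Real.rpow_le_rpow (by positivity) hle hα0) hF0.le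
    · refine le_trans ?_ (h2 (hlt.le.trans hradius))
      have e1 : F Q ^ ((2 * s - α) / (2 * s)) = (F Q ^ (-(1 / (2 * s)))) ^ (α - 2 * s) := by
        rw [← Real.rpow_mul hF0.le]
        congr 1
        field_simp
        ring
      rw [e1]
      exact Real.rpow_le_rpow_of_nonpos ht hlt.le (by linarith)
  have e1 : F Q ^ ((2 * s - α) / (2 * s)) = X ^ (1 + θ) := by
    rw [hX, ← Real.rpow_mul hF0.le]
    congr 1
    rw [hα]
    field_simp
    ring
  have e2 : N * Q ^ (γ - 2 * s) ≤ X ^ (1 + θ) := by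
    have e3 := Real.rpow_le_rpow (by positivity) hXN (by linarith : 0 ≤ 1 + θ)
    refine le_trans ?_ e3
    rw [Real.mul_rpow (by positivity) (by positivity), ← Real.rpow_mul hQ0.le]
    refine mul_le_mul ?_ (Real.rpow_le_rpow_of_exponent_le hQ1 ?_) (by positivity)
      (by positivity)
    · calc N = N ^ (1 : ℝ) := (Real.rpow_one N).symm
        _ ≤ N ^ (1 + θ) := Real.rpow_le_rpow_of_exponent_le (by linarith) (by linarith)
    -- This is `(1-β)s ≤ (1-β)γ`, from `s < 1 ≤ γ`; it yields `γ - 2s ≤ (1+θ)((2-β)γ - 2s)`.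
    · have e4 : θ * (2 * s) ≤ (1 - β) * γ := by nlinarith
      have e5 : 0 ≤ θ * ((2 - β) * γ) := by
        have : 0 < 2 - β := by linarith
        positivity
      nlinarith
  have e3 : (Q / k) ^ (γ - 2 * s) = Q ^ (γ - 2 * s) * k ^ (2 * s - γ) := by
    rw [Real.div_rpow hQ0.le hk0.le, div_eq_mul_inv, ← Real.rpow_neg hk0.le]
    congr 2
    ring
  rw [e1, e3] at hupper
  have e4 : 0 < Q ^ (γ - 2 * s) := by positivity
  have e5 := e2.trans hupper
  nlinarith [mul_pos hN2 e4]

/-- By convexity the slope of the chord over `[a, b]` is at most `f'(b)`, hence at most `f'(Q)`,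
which is nonpositive since `f` decreases. -/
theorem deriv_mul_le_sub_of_convexOn {f : ℝ → ℝ} (hfm : AntitoneOn f (Ioi 0))
    (hfd : ContDiffOn ℝ 1 f (Ioi 0)) (hfc : ConvexOn ℝ (Ioi 0) f) {a b Q : ℝ} (ha : 0 < a)
    (hab : a < b) (hbQ : b ≤ Q) : |deriv f Q| * (b - a) ≤ f a - f b := by
  have hdiff : ∀ x ∈ Ioi (0 : ℝ), DifferentiableAt ℝ f x := fun x hx =>
    (hfd.differentiableOn (by norm_num)).differentiableAt (Ioi_mem_nhds hx)
  have hb : 0 < b := ha.trans hab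
  have hQ : 0 < Q := hb.trans_le hbQ
  have h1 : deriv f Q ≤ 0 := by
    have h2 : f (Q + 1) ≤ f Q := hfm (mem_Ioi.2 hQ) (mem_Ioi.2 (by linarith)) (by linarith)
    have h3 := hfc.deriv_le_slope (mem_Ioi.2 hQ) (mem_Ioi.2 (by linarith : 0 < Q + 1))
      (by linarith) (hdiff Q hQ)
    rw [slope_def_field] at h3
    simp only [add_sub_cancel_left, div_one] at h3
    linarith
  have h4 := (hfc.slope_le_deriv ha hb hab (hdiff b hb)).trans
    (hfc.monotoneOn_deriv hdiff hb hQ hbQ)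
  rw [slope_def_field, div_le_iff₀ (sub_pos.2 hab)] at h4
  rw [abs_of_nonpos h1]
  linarith

end NonlocalLiouville

/-! ### The two cases assembled. -/

theorem mainTheorem6 (n : ℕ) (s lam Lam : ℝ) (hs0 : 0 < s) (hs1 : s < 1)
    (hlam : 0 < lam) (hLam : lam ≤ Lam)
    (I : (NonlocalLiouville.Rn n → ℝ) → NonlocalLiouville.Rn n → ℝ)
    (hI : NonlocalLiouville.IsEllipticSym n s lam Lam I)
    (f : ℝ → ℝ) (hfc : ContinuousOn f (Ioi 0)) (hfm : AntitoneOn f (Ioi 0)) (γ : ℝ)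
    (hcase : γ < min 1 (2 * s) ∨
      (1 / 2 < s ∧ ContDiffOn ℝ 1 f (Ioi 0) ∧ ConvexOn ℝ (Ioi 0) f ∧
        ∃ β : ℝ, 0 < β ∧ β < 1 ∧
          limsup (fun R : ℝ => ((R ^ (2 * s - (2 - β) * γ) *
            |deriv f (R ^ γ)| ^ ((2 * s - 1) / (2 * s)) : ℝ) : EReal)) atTop = ⊤)) :
    ¬ ∃ u : NonlocalLiouville.Rn n → ℝ,
        (∀ x, 0 < u x) ∧
        NonlocalLiouville.IsViscositySolution s I f u ∧
        (∃ C : ℝ, ∀ x, |u x| ≤ C * (1 + ‖x‖) ^ γ) ∧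
        ¬ ∃ c : ℝ, ∀ x, u x = c := by
  rintro ⟨u, hu, hsol, ⟨C, hC⟩, hconst⟩
  rcases isEmpty_or_nonempty (Fin n) with hn | hn
  -- In dimension zero the space is a single point.
  · exact hconst ⟨u 0, fun x => congrArg u (Subsingleton.elim x 0)⟩
  obtain ⟨p, q, hpq⟩ : ∃ p q, u q < u p := by
    by_contra! h
    exact hconst ⟨u 0, fun x => le_antisymm (h x 0) (h 0 x)⟩
  have hC0 : 0 < C := by
    have h1 := (hu 0).trans_le ((le_abs_self _).trans (hC 0))
    rwa [norm_zero, add_zero, Real.one_rpow, mul_one] at h1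
  have hg : ∀ x, u x ≤ C * (1 + ‖x‖) ^ γ := fun x => (le_abs_self _).trans (hC x)
  rcases lt_or_ge γ (min 1 (2 * s)) with hγ | hγ
  · set m := min 1 (2 * s) with hm
    have hm0 : 0 < m := lt_min one_pos (by linarith)
    -- The exponent `γ` may be nonpositive; the growth bound persists for any larger exponent, so a
    -- positive one is chosen below `min 1 (2s)`.
    obtain ⟨γ', h1, h2⟩ := exists_between (max_lt hγ hm0)
    obtain ⟨α, h3, h4⟩ := exists_between h2
    have hγ' : 0 < γ' := (le_max_right _ _).trans_lt h1
    obtain ⟨D, R₀, hD, hR₀, h⟩ := NonlocalLiouville.exists_doubling_estimate hI hs0 hs1 hlam hLam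
      hfm hsol hu hC0 hγ'
      (fun x => (hg x).trans (mul_le_mul_of_nonneg_left (Real.rpow_le_rpow_of_exponent_le
        (by linarith [norm_nonneg x]) ((le_max_left _ _).trans h1.le)) hC0.le))
      (hγ'.trans h3) (h4.trans_le (min_le_left _ _)) hpq
    refine NonlocalLiouville.false_of_estimate_of_lt hs0 hγ' h3 (h4.trans_le (min_le_right _ _))
      hD hR₀ fun R hR => ?_
    obtain ⟨t, ht, e1, -, e2⟩ := h R hR 0 le_rfl fun a b ha hab _ => by
      rw [zero_mul]
      exact sub_nonneg.2 (hfm (mem_Ioi.2 ha) (mem_Ioi.2 (ha.trans hab)) hab.le)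
    exact ⟨t, ht, e1, e2⟩
  · obtain ⟨hs, hfd, hfx, β, hβ0, hβ1, hlimsup⟩ := hcase.resolve_left (not_lt.2 hγ)
    have hγ1 : 1 ≤ γ := by rwa [min_eq_left (by linarith)] at hγ
    have hα0 : 0 < 1 - (1 - β) / 2 * (2 * s - 1) := by nlinarith
    have hα1 : 1 - (1 - β) / 2 * (2 * s - 1) < 1 := by nlinarith
    obtain ⟨D, R₀, hD, hR₀, h⟩ := NonlocalLiouville.exists_doubling_estimate hI hs0 hs1 hlam hLam
      hfm hsol hu hC0 (by linarith) hg hα0 hα1 hpq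
    refine NonlocalLiouville.false_of_estimate_of_derivative hs hs1 hγ1 hβ0 hβ1 hD hR₀
      (F := fun R => |deriv f (R ^ γ)|) (fun R => abs_nonneg _) (fun N => ?_)
      fun R hR Q hQ hDQ => ?_
    · refine (frequently_lt_of_lt_limsup (b := (N : EReal)) (by isBoundedDefault) ?_).mono
        fun R hR => EReal.coe_lt_coe_iff.1 hR
      rw [hlimsup]
      exact EReal.coe_lt_top N
    · obtain ⟨t, ht, -, e1, e2⟩ := h R hR |deriv f (Q ^ γ)| (abs_nonneg _) fun a b ha hab hb =>
        NonlocalLiouville.deriv_mul_le_sub_of_convexOn hfm hfd hfx ha hab (hb.trans hDQ)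
      exact ⟨t, ht, e1, e2⟩
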